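/- Let $n\ge 0$, let $\mathfrak S_n$ be the set of permutations of $[n]=\{1,\dots,n\}$, and for a (generalized) pattern $\tau$ let $\mathfrak S_n(\tau)$ be the set of those permutations that contain no instance of $\tau$. (An instance of $31\text{-}2$ in $\pi$ is a pair of positions $i+1<j$ with $\pi(i+1)<\pi(j)<\pi(i)$; an instance of $2\text{-}31$ is a pair $i<j$ with $j+1\le n$ and $\pi(j+1)<\pi(i)<\pi(j)$, and it starts with the entry $\pi(i)$; an instance of $3\text{-}2\text{-}1$ is a triple $i<j<k$ with $\pi(i)>\pi(j)>\pi(k)$.) **The map $\Psi$.** For $\pi\in\mathfrak S_n$ with $n\ge1$ let $\mathrm{DT}$, $\mathrm{DB}$ be the sets of all descent tops $\pi(i)$ and descent bottoms $\pi(i+1)$, where $\pi(i)>\pi(i+1)$, and let $\mathrm{NDB}=[n]\setminus\mathrm{DT}$, $\mathrm{NDT}=[n]\setminus\mathrm{DB}$. For $a\in[n]$ let $\mathrm{remb}_\pi(a)$ be the number of instances of $2\text{-}31$ in $\pi$ that start with the entry $a$. Put $$W=\{a+1: a\in \mathrm{DB}\}\cup\{1\},\quad W'=\{a-1: a\in \mathrm{DT}\}\cup\{n\},$$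 $$N=\{a+1: a\in \mathrm{NDT},\ a\neq n\},\quad N'=\{a-1: a\in \mathrm{NDB},\ a\ne 1\}.$$ The permutation $\sigma=\Psi(\pi)$ is obtained as follows. Process the elements $a\in W$ from the largest to the smallest: let $\sigma(a)$ be the $(\mathrm{remb}_\pi(a)+1)$-st smallest among those elements of $W'$ that are $\ge a$ and have not been used yet. Then process the elements $c\in N$ from the smallest to the largest: let $\sigma(c)$ be the $(\mathrm{remb}_\pi(c)+1)$-st largest among those elements of $N'$ that are $<c$ and have not been used yet. (For $n=0$, $\Psi$ is the identity of the one-element set $\mathfrak S_0$.) **Permutation tableaux.** A permutation tableau of size $n$ consists of a $k\times(n-k)$ rectangle, a Young diagram $Y$ contained in it and aligned with its top and left edges, and a filling of the cells of $Y$ with 0s and 1s such that each column of the rectangle contains a 1, and each cell of $Y$ that has a 1 above it in the same column and a 1 to the left of it in the same row contains a 1. Label the steps of the southeast border path of $Y$, from the northeast to the southwest corner of the rectangle, by $1,\dots,n$; this labels the rows (through the vertical steps) and the columns (through the horizontal steps). The permutation $\Phi(T)$ of a tableau $T$ maps the label $i$ of a row (column) to the label of the border step at which the following path ends: it enters that row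 from the west going east (that column from the north going south), goes straight through each 0, and switches between the directions east and south at each 1. **Theorem.** The map $\Psi:\mathfrak S_n\to\mathfrak S_n$ is a well-defined bijection, $\Phi$ is a bijection from the permutation tableaux of size $n$ onto $\mathfrak S_n$, and $$\Psi(\mathfrak S_n(31\text{-}2))=\mathfrak S_n(3\text{-}2\text{-}1)=\{\sigma\in\mathfrak S_n:\ \text{the rows of the tableau } \Phi^{-1}(\sigma)\text{ are nondecreasing from left to right and its columns from top to bottom}\}.$$ -/

import Mathlib

/-- A generalized permutation pattern with `k` letters: `letter` lists the letters from left to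
right (only their relative order matters), and `glued` is the set of (0-based) indices `a` such
that the letters number `a` and `a + 1` are not separated by a dash. -/
structure GenPattern (k : ℕ) where
  letter : Fin k → ℕ
  glued : Finset ℕ

/-- The pattern `31-2`. -/
def pat31_2 : GenPattern 3 := ⟨![3, 1, 2], {0}⟩

/-- The pattern `2-31`. -/
def pat2_31 : GenPattern 3 := ⟨![2, 3, 1], {1}⟩

/-- The classical pattern `3-2-1`. -/
def pat3_2_1 : GenPattern 3 := ⟨![3, 2, 1], ∅⟩

/-- The entries of `π` at the positions `f 0 < f 1 < ⋯` form an instance of the pattern `τ`.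
Here and below, `Fin n = {0, …, n - 1}` plays the role of `{1, …, n}`, for positions and for
values. -/
def IsInstance {n k : ℕ} (τ : GenPattern k) (π : Equiv.Perm (Fin n)) (f : Fin k → Fin n) : Prop :=
  (∀ a b : Fin k, a < b → f a < f b) ∧
  (∀ a b : Fin k, π (f a) < π (f b) ↔ τ.letter a < τ.letter b) ∧
  (∀ a b : Fin k, (a : ℕ) ∈ τ.glued → (b : ℕ) = a + 1 → (f b : ℕ) = f a + 1)

instance {n k : ℕ} (τ : GenPattern k) (π : Equiv.Perm (Fin n)) :
    DecidablePred (IsInstance τ π) := fun f => by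
  unfold IsInstance
  infer_instance

/-- The set of all permutations that avoid `τ`. -/
def avoiders {k : ℕ} (n : ℕ) (τ : GenPattern k) : Set (Equiv.Perm (Fin n)) :=
  {π | ∀ f : Fin k → Fin n, ¬ IsInstance τ π f}

namespace SteinWil

variable {n : ℕ}

/-- The right embracing number of the entry with value `a`: the number of instances of `2-31`
in `π` that start with the entry `a`. -/
def remb (π : Equiv.Perm (Fin n)) (a : Fin n) : ℕ :=
  (Finset.univ.filter fun f : Fin 3 → Fin n => IsInstance pat2_31 π f ∧ π (f 0) = a).card

/-- Descent bottoms (values). -/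
def db (π : Equiv.Perm (Fin n)) : Finset (Fin n) :=
  Finset.univ.filter fun v => ∃ i j : Fin n, (j : ℕ) = i + 1 ∧ π j < π i ∧ v = π j

/-- Descent tops (values). -/
def dt (π : Equiv.Perm (Fin n)) : Finset (Fin n) :=
  Finset.univ.filter fun v => ∃ i j : Fin n, (j : ℕ) = i + 1 ∧ π j < π i ∧ v = π i

/-- Non-descent tops; the first entry counts as one. -/
def ndt (π : Equiv.Perm (Fin n)) : Finset (Fin n) := (db π)ᶜ

/-- Non-descent bottoms; the last entry counts as one. -/
def ndb (π : Equiv.Perm (Fin n)) : Finset (Fin n) := (dt π)ᶜ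

/-- `{a + 1 | a ∈ db π}`, together with the smallest element: the prescribed set of weak
excedance bottoms of the image. -/
def wexb (π : Equiv.Perm (Fin n)) : Finset (Fin n) :=
  Finset.univ.filter fun x => (∃ a ∈ db π, (x : ℕ) = a + 1) ∨ (x : ℕ) = 0

/-- `{a + 1 | a ∈ ndt π}` without the largest `a`: the prescribed set of nonwex tops. -/
def nwext (π : Equiv.Perm (Fin n)) : Finset (Fin n) :=
  Finset.univ.filter fun x => ∃ a ∈ ndt π, (x : ℕ) = a + 1

/-- `{a - 1 | a ∈ dt π}`, together with the largest element: the prescribed set of weak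
excedance tops. -/
def wext (π : Equiv.Perm (Fin n)) : Finset (Fin n) :=
  Finset.univ.filter fun x => (∃ a ∈ dt π, (x : ℕ) + 1 = a) ∨ (x : ℕ) + 1 = n

/-- `{a - 1 | a ∈ ndb π}` without the smallest `a`: the prescribed set of nonwex bottoms. -/
def nwexb (π : Equiv.Perm (Fin n)) : Finset (Fin n) :=
  Finset.univ.filter fun x => ∃ a ∈ ndb π, (x : ℕ) + 1 = a

/-- The `(remb π a + 1)`-st smallest element of `T` among those that are at least `a`.
(The default value of `getD` is never used in the construction below.) -/
def pickWex (π : Equiv.Perm (Fin n)) (a : Fin n) (T : Finset (Fin n)) : Fin n :=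
  ((T.filter fun b => a ≤ b).sort (· ≤ ·)).getD (remb π a) a

/-- The `(remb π c + 1)`-st largest element of `T` among those that are less than `c`. -/
def pickNwex (π : Equiv.Perm (Fin n)) (c : Fin n) (T : Finset (Fin n)) : Fin n :=
  ((T.filter fun d => d < c).sort (· ≥ ·)).getD (remb π c) c

/-- Go through the list of positions; the current position `a` gets the value `pick a T`, where
`T` is the set of values that are still available, and this value is then removed from `T`. -/
def assign (pick : Fin n → Finset (Fin n) → Fin n) :
    List (Fin n) → Finset (Fin n) → Fin n → Fin n
  | [], _ => id
  | a :: L, T => Function.update (assign pick L (T.erase (pick a T))) a (pick a T)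

/-- The image `Ψ(π)` as a function: the weak excedance bottoms are processed from the largest to
the smallest, and the nonwex tops from the smallest to the largest. -/
def psiFun (π : Equiv.Perm (Fin n)) (i : Fin n) : Fin n :=
  if i ∈ wexb π then
    assign (pickWex π) ((wexb π).sort (· ≥ ·)) (wext π) i
  else
    assign (pickNwex π) ((nwext π).sort (· ≤ ·)) (nwexb π) i

end SteinWil

/-- Permutation tableaux of size `n`: a Young diagram inside a `rows × cols` rectangle with
`rows + cols = n` (aligned with its top and left edges), and a filling of its cells with zeros and
ones; `ones` is the set of cells that contain a one. Cells are (row, column), counted from 0. -/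
@[ext]
structure PermTableau (n : ℕ) where
  rows : ℕ
  cols : ℕ
  rows_add_cols : rows + cols = n
  shape : YoungDiagram
  shape_sub : ∀ r c : ℕ, (r, c) ∈ shape → r < rows ∧ c < cols
  ones : Finset (ℕ × ℕ)
  ones_sub : ∀ r c : ℕ, (r, c) ∈ ones → (r, c) ∈ shape
  column : ∀ c < cols, ∃ r, (r, c) ∈ ones
  hinge : ∀ r r' c c' : ℕ, r' < r → c' < c → (r, c) ∈ shape →
    (r', c) ∈ ones → (r, c') ∈ ones → (r, c) ∈ ones

namespace PermTableau

variable {n : ℕ}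

/-- The label (from 0 to `n - 1`) of the vertical step of the southeast border at the end of
row `r`, the border being traversed from the northeast to the southwest corner of the
rectangle. -/
def rowLabel (T : PermTableau n) (r : ℕ) : ℕ := r + (T.cols - T.shape.rowLen r)

/-- The label (from 0 to `n - 1`) of the horizontal step of the southeast border at the end of
column `c`. -/
def colLabel (T : PermTableau n) (c : ℕ) : ℕ := (T.cols - 1 - c) + T.shape.colLen c

/-- The label of the border step at which a path leaves the diagram. The path is about to enter
cell `(r, c)`, travelling east if `east = true` and south otherwise. It goes straight through a
zero, and switches direction at a one. -/
def exitLabel (T : PermTableau n) (east : Bool) (r c : ℕ) : ℕ :=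
  if _h : (r, c) ∈ T.shape then
    -- the path leaves the cell eastward if it contains a zero and it came from the west,
    -- or if it contains a one and it came from the north
    if east = decide ((r, c) ∉ T.ones) then T.exitLabel true r (c + 1)
    else T.exitLabel false (r + 1) c
  else if east then T.rowLabel r else T.colLabel c
termination_by T.rows + T.cols - (r + c)
decreasing_by
  all_goals
    have := T.shape_sub r c _h
    omega

/-- `π` is the permutation of the tableau `T`: the zigzag path that starts at the west end of a
row, going east, or at the north end of a column, going south, with label `i`, ends at the border
step with label `π i`. -/
def HasPerm (T : PermTableau n) (π : Equiv.Perm (Fin n)) : Prop :=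
  (∀ (i : Fin n) (r : ℕ), r < T.rows → (i : ℕ) = T.rowLabel r → (π i : ℕ) = T.exitLabel true r 0) ∧
  (∀ (i : Fin n) (c : ℕ), c < T.cols → (i : ℕ) = T.colLabel c → (π i : ℕ) = T.exitLabel false 0 c)

/-- The entries of each row are nondecreasing from left to right, and those of each column from
top to bottom. -/
def Nondecreasing (T : PermTableau n) : Prop :=
  (∀ r c c' : ℕ, c ≤ c' → (r, c') ∈ T.shape → (r, c) ∈ T.ones → (r, c') ∈ T.ones) ∧
  (∀ r r' c : ℕ, r ≤ r' → (r', c) ∈ T.shape → (r, c) ∈ T.ones → (r', c) ∈ T.ones)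

end PermTableau

/-! ### Greedy assignments and ranks. -/

namespace SteinWil

variable {n : ℕ}

/-! For a value `a`, let `cross π a` count the descents whose bottom and top enclose `a`. Each such
descent forms with `a` an instance of 2-31 or of 31-2, depending on the side on which `a` lies. So
`remb π a ≤ cross π a`, and π avoids 31-2 iff equality holds for every `a`
(`mem_avoiders_iff_remb_eq_cross`).

Counting descents gives #{W' ≥ a} = #{W > a} + `cross π a` + 1 (`card_wext_ge_eq`), and
complementation gives the analogue for the other phase. Hence each greedy choice has enough room,
and σ = Ψ(π) is a permutation whose weak excedances are at the positions in W, with values in W'.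
For a weak excedance `a` of σ, `cross π a` counts the x < a with a ≤ σ(x), and `remb π a` counts
those that moreover satisfy σ(x) < σ(a); non-excedances behave symmetrically. Equality everywhere
thus says that σ increases on its weak excedances and on the remaining positions, which is avoidance
of 3-2-1 (`mem_avoiders_321_iff`). Conversely σ determines the descent bottoms, the descent tops and
all embracing numbers of π, and these determine π by inserting its entries in increasing order
(`eq_of_db_dt_remb_eq`).

For Φ, the last border step of a tableau is removed. It belongs to an empty bottom row or to a
leftmost column of full height, whose ones lie in unrestricted rows, that is, rows in which no zero
has a one above it. On the permutation side this is the removal of the largest element from a cycle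
through a set of left-to-right maxima (`IsExt`). Unrestricted rows correspond to left-to-right
maxima, so both recursions have the same choices and Φ is bijective.

In a nondecreasing tableau a path becomes a staircase after its first one, so its end is explicit
and the 3-2-1 criterion can be checked. Conversely, if g extends f and avoids 3-2-1, then f avoids
it and every value of f above the smallest inserted one belongs to the cycle (`IsExt.avoids`); a
count then forces the new column to keep the tableau nondecreasing. -/

theorem card_filter_lt_getElem {α : Type*} [DecidableEq α] (lt : α → α → Prop) [DecidableRel lt]
    (irr : ∀ a, ¬ lt a a) (asymm : ∀ a b, lt a b → ¬ lt b a) :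
    ∀ (l : List α), l.Pairwise lt → ∀ (k : ℕ) (hk : k < l.length),
      (l.toFinset.filter fun b => lt b l[k]).card = k
  | [], _, k, hk => by simp at hk
  | a :: l, hl, k, hk => by
    rw [List.pairwise_cons] at hl
    have ha : a ∉ l := fun h => irr a (hl.1 a h)
    rcases k with _ | k
    · rw [Finset.card_eq_zero, Finset.filter_eq_empty_iff]
      intro x hx
      rcases List.mem_cons.1 (List.mem_toFinset.1 hx) with rfl | h
      · exact irr _
      · exact asymm _ _ (hl.1 x h)
    · have hk' : k < l.length := by simpa using hk
      have ih := card_filter_lt_getElem lt irr asymm l hl.2 k hk'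
      rw [List.toFinset_cons, Finset.filter_insert, if_pos, Finset.card_insert_of_notMem]
      · simpa using ih
      · simp [ha]
      · exact hl.1 _ (List.getElem_mem _)

/-- The specification of a greedy assignment: the position `a` receives the element of rank `rem a`
among the admissible elements that were not used before. -/
theorem assign_spec (r lt bef ok : Fin n → Fin n → Prop) [DecidableRel r] [DecidableRel lt]
    [DecidableRel bef] [DecidableRel ok] [IsTrans (Fin n) r] [Std.Antisymm r] [Std.Total r]
    (hlt : ∀ a b, lt a b ↔ r a b ∧ a ≠ b)
    (bef_asymm : ∀ a b, bef a b → ¬ bef b a) (ok_mono : ∀ a x b, bef a x → ok a b → ok x b)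
    (rem : Fin n → ℕ) (pick : Fin n → Finset (Fin n) → Fin n)
    (hpick : ∀ a T, pick a T = ((T.filter (ok a)).sort r).getD (rem a) a) :
    ∀ (L : List (Fin n)) (T : Finset (Fin n)), L.Pairwise bef →
      (∀ a ∈ L, (L.toFinset.filter fun x => bef x a).card + rem a < (T.filter (ok a)).card) →
      (∀ a ∈ L, assign pick L T a ∈ T ∧ ok a (assign pick L T a)) ∧
      (∀ a ∈ L, ∀ b ∈ L, assign pick L T a = assign pick L T b → a = b) ∧
      (∀ a ∈ L, rem a = (T.filter fun b => ok a b ∧ (∀ x ∈ L, bef x a → assign pick L T x ≠ b) ∧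
        lt b (assign pick L T a)).card)
  | [], T, _, _ => by simp
  | a :: L, T, hL, hc => by
    rw [List.pairwise_cons] at hL
    have irr : ∀ a, ¬ bef a a := fun a h => bef_asymm a a h h
    have ha : a ∉ L := fun h => irr a (hL.1 a h)
    set p := pick a T with hp
    have hca : rem a < (T.filter (ok a)).card := by
      have := hc a List.mem_cons_self
      omega
    set l := (T.filter (ok a)).sort r with hl
    have hlen : rem a < l.length := by rwa [hl, Finset.length_sort]
    have hpl : p = l[rem a] := by
      rw [hp, hpick, ← hl, List.getD_eq_getElem _ _ hlen]
    have hpm : p ∈ T.filter (ok a) := by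
      rw [← Finset.mem_sort (r := r), ← hl, hpl]
      exact List.getElem_mem _
    rw [Finset.mem_filter] at hpm
    have hrank : rem a = (T.filter fun b => ok a b ∧ lt b p).card := by
      have hlp : l.Pairwise lt := by
        have h1 : l.Pairwise r := Finset.pairwise_sort _ _
        have h2 : l.Nodup := Finset.sort_nodup _ _
        exact (h1.and h2).imp fun h => (hlt _ _).2 h
      have := card_filter_lt_getElem lt (fun a h => ((hlt _ _).1 h).2 rfl)
        (fun a b h h' => ((hlt _ _).1 h).2
          (antisymm_of r ((hlt _ _).1 h).1 ((hlt _ _).1 h').1)) l hlp (rem a) hlen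
      rw [← hpl, hl, Finset.sort_toFinset, Finset.filter_filter] at this
      exact this.symm
    -- By `ok_mono` the value `p` is admissible for every later position, so its removal costs
    -- exactly one candidate. This is offset by `a`, which is no longer counted among the preceding
    -- positions.
    have hcond : ∀ x ∈ L, (L.toFinset.filter fun y => bef y x).card + rem x
        < ((T.erase p).filter (ok x)).card := by
      intro x hx
      have h1 := hc x (List.mem_cons_of_mem _ hx)
      rw [List.toFinset_cons, Finset.filter_insert, if_pos (hL.1 x hx),
        Finset.card_insert_of_notMem (by simp [ha])] at h1
      have h2 : (T.erase p).filter (ok x) = (T.filter (ok x)).erase p := by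
        ext b; simp only [Finset.mem_filter, Finset.mem_erase]; tauto
      rw [h2, Finset.card_erase_of_mem
        (Finset.mem_filter.2 ⟨hpm.1, ok_mono _ _ _ (hL.1 x hx) hpm.2⟩)]
      omega
    obtain ⟨i1, i2, i3⟩ := assign_spec r lt bef ok hlt bef_asymm ok_mono rem pick hpick L
      (T.erase p) hL.2 hcond
    have e1 : assign pick (a :: L) T a = p := by simp [assign, hp]
    have e2 : ∀ x ∈ L, assign pick (a :: L) T x = assign pick L (T.erase p) x := by
      intro x hx
      have : x ≠ a := fun h => ha (h ▸ hx)
      simp [assign, this, hp]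
    refine ⟨?_, ?_, ?_⟩
    · intro x hx
      rcases List.mem_cons.1 hx with rfl | hx
      · rw [e1]; exact hpm
      · rw [e2 x hx]
        exact ⟨Finset.mem_of_mem_erase (i1 x hx).1, (i1 x hx).2⟩
    · intro x hx y hy
      rcases List.mem_cons.1 hx with rfl | hx' <;> rcases List.mem_cons.1 hy with rfl | hy'
      · simp
      · rw [e1, e2 y hy']
        intro h
        exact absurd h.symm (Finset.ne_of_mem_erase (i1 y hy').1)
      · rw [e1, e2 x hx']
        intro h
        exact absurd h (Finset.ne_of_mem_erase (i1 x hx').1)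
      · rw [e2 x hx', e2 y hy']; exact i2 x hx' y hy'
    · intro x hx
      rcases List.mem_cons.1 hx with rfl | hx
      · rw [e1, hrank]
        congr 1
        ext b
        simp only [Finset.mem_filter]
        refine and_congr_right fun _ => and_congr_right fun _ => ?_
        refine (and_iff_right ?_).symm
        intro y hy hyx
        rcases List.mem_cons.1 hy with rfl | hy
        · exact absurd hyx (irr _)
        · exact absurd hyx (bef_asymm _ _ (hL.1 y hy))
      · rw [e2 x hx, i3 x hx]
        congr 1
        ext b
        simp only [Finset.mem_filter, Finset.mem_erase, List.forall_mem_cons, e1]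
        have : (∀ y ∈ L, bef y x → assign pick (a :: L) T y ≠ b) ↔
            (∀ y ∈ L, bef y x → assign pick L (T.erase p) y ≠ b) :=
          forall₂_congr fun y hy => by rw [e2 y hy]
        rw [this]
        have := hL.1 x hx
        constructor
        · rintro ⟨⟨h1, h2⟩, h3, h4, h5⟩
          exact ⟨h2, h3, ⟨fun _ => Ne.symm h1, h4⟩, h5⟩
        · rintro ⟨h2, h3, ⟨h1, h4⟩, h5⟩
          exact ⟨⟨Ne.symm (h1 this), h2⟩, h3, h4, h5⟩

end SteinWil

/-! ### The three patterns in terms of explicit inequalities. -/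

theorem mem_avoiders_pat3_2_1 {n : ℕ} (π : Equiv.Perm (Fin n)) :
    π ∈ avoiders n pat3_2_1 ↔ ∀ i j k, i < j → j < k → π k < π j → π j < π i → False := by
  simp only [avoiders, Set.mem_ofPred_eq, IsInstance, pat3_2_1]
  constructor
  · intro h i j k hij hjk h1 h2
    apply h ![i, j, k]
    refine ⟨?_, ?_, by simp⟩
    · intro a b
      fin_cases a <;> fin_cases b <;> simp [hij, hjk, hij.trans hjk]
    · intro a b
      fin_cases a <;> fin_cases b <;> simp [h1, h2, h1.trans h2, h1.le, h2.le, (h1.trans h2).le]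
  · intro h f ⟨h1, h2, _⟩
    refine h (f 0) (f 1) (f 2) (h1 _ _ (by decide)) (h1 _ _ (by decide)) ?_ ?_
    · rw [h2]; simp
    · rw [h2]; simp

theorem mem_avoiders_pat31_2 {n : ℕ} (π : Equiv.Perm (Fin n)) :
    π ∈ avoiders n pat31_2 ↔
      ∀ i j k : Fin n, (j : ℕ) = i + 1 → j < k → π j < π k → π k < π i → False := by
  simp only [avoiders, Set.mem_ofPred_eq, IsInstance, pat31_2]
  constructor
  · intro h i j k hij hjk h1 h2
    have hij' : i < j := by rw [Fin.lt_def]; omega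
    apply h ![i, j, k]
    refine ⟨?_, ?_, ?_⟩
    · intro a b
      fin_cases a <;> fin_cases b <;> simp [hij', hjk, hij'.trans hjk]
    · intro a b
      fin_cases a <;> fin_cases b <;> simp [h1, h2, h1.trans h2, h1.le, h2.le, (h1.trans h2).le]
    · intro a b
      fin_cases a <;> fin_cases b <;> simp [hij]
  · intro h f ⟨h1, h2, h3⟩
    refine h (f 0) (f 1) (f 2) (h3 _ _ (by simp) (by simp)) (h1 _ _ (by decide)) ?_ ?_
    · rw [h2]; simp
    · rw [h2]; simp

theorem isInstance_pat2_31 {n : ℕ} (π : Equiv.Perm (Fin n)) (f : Fin 3 → Fin n) :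
    IsInstance pat2_31 π f ↔ f 0 < f 1 ∧ (f 2 : ℕ) = f 1 + 1 ∧ π (f 2) < π (f 0) ∧
      π (f 0) < π (f 1) := by
  simp only [IsInstance, pat2_31]
  constructor
  · intro ⟨h1, h2, h3⟩
    refine ⟨h1 _ _ (by decide), h3 _ _ (by simp) (by simp), ?_, ?_⟩
    · rw [h2]; simp
    · rw [h2]; simp
  · rintro ⟨h1, h2, h3, h4⟩
    have h5 : f 1 < f 2 := by rw [Fin.lt_def]; omega
    refine ⟨?_, ?_, ?_⟩
    · intro a b
      fin_cases a <;> fin_cases b <;> simp [h1, h5, h1.trans h5]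
    · intro a b
      fin_cases a <;> fin_cases b <;> simp [h3, h4, h3.trans h4, h3.le, h4.le, (h3.trans h4).le]
    · intro a b
      fin_cases a <;> fin_cases b <;> simp [h2]

/-! ### Descents, embracing numbers and the room left for the greedy choices. -/

namespace SteinWil

variable {n : ℕ}

/-- The descents of `π`, as pairs of adjacent positions. -/
def desc (π : Equiv.Perm (Fin n)) : Finset (Fin n × Fin n) :=
  Finset.univ.filter fun p => (p.2 : ℕ) = p.1 + 1 ∧ π p.2 < π p.1

theorem mem_desc {π : Equiv.Perm (Fin n)} {p : Fin n × Fin n} :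
    p ∈ desc π ↔ (p.2 : ℕ) = p.1 + 1 ∧ π p.2 < π p.1 := by simp [desc]

/-- The number of descents whose bottom and top enclose the value `a`. -/
def cross (π : Equiv.Perm (Fin n)) (a : Fin n) : ℕ :=
  ((desc π).filter fun p => π p.2 < a ∧ a < π p.1).card

theorem remb_eq (π : Equiv.Perm (Fin n)) (a : Fin n) :
    remb π a =
      ((desc π).filter fun p => (π p.2 < a ∧ a < π p.1) ∧ π.symm a < p.1).card := by
  unfold remb
  refine Finset.card_bij' (fun f _ => (f 1, f 2)) (fun p _ => ![π.symm a, p.1, p.2]) ?_ ?_ ?_ ?_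
  · intro f hf
    simp only [Finset.mem_filter, Finset.mem_univ, true_and, isInstance_pat2_31] at hf
    obtain ⟨⟨h1, h2, h3, h4⟩, rfl⟩ := hf
    simp [mem_desc, h1, h2, h3, h4, h3.trans h4]
  · intro p hp
    simp only [Finset.mem_filter, mem_desc] at hp
    obtain ⟨⟨h1, h2⟩, ⟨h3, h4⟩, h5⟩ := hp
    simp [isInstance_pat2_31, h1, h3, h4, h5]
  · intro f hf
    simp only [Finset.mem_filter, Finset.mem_univ, true_and] at hf
    obtain ⟨_, rfl⟩ := hf
    ext i
    fin_cases i <;> simp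
  · intro p _
    simp

theorem remb_le_cross (π : Equiv.Perm (Fin n)) (a : Fin n) : remb π a ≤ cross π a := by
  rw [remb_eq, cross]
  exact Finset.card_le_card (Finset.monotone_filter_right _ fun _ _ h => h.1)

theorem remb_eq_cross_iff (π : Equiv.Perm (Fin n)) (a : Fin n) :
    remb π a = cross π a ↔
      ∀ p ∈ desc π, π p.2 < a → a < π p.1 → π.symm a < p.1 := by
  rw [remb_eq, cross, ← Finset.filter_filter, Finset.card_filter_eq_iff]
  simp only [Finset.mem_filter, and_imp]

/-- A descent enclosing `a` that is not counted by `remb π a` lies to the left of `a`, and then it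
forms a 31-2 with `a`. -/
theorem mem_avoiders_iff_remb_eq_cross (π : Equiv.Perm (Fin n)) :
    π ∈ avoiders n pat31_2 ↔ ∀ a, remb π a = cross π a := by
  rw [mem_avoiders_pat31_2]
  simp only [remb_eq_cross_iff]
  constructor
  · intro h a p hp h1 h2
    by_contra h3
    rw [mem_desc] at hp
    have e1 : π.symm a ≠ p.1 := fun h => by rw [← h] at h2; simp at h2
    have e2 : π.symm a ≠ p.2 := fun h => by rw [← h] at h1; simp at h1
    refine h p.1 p.2 (π.symm a) hp.1 ?_ (by simpa using h1) (by simpa using h2)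
    rw [Fin.lt_def] at *
    rw [Ne, Fin.ext_iff] at e1 e2
    omega
  · intro h i j k hij hjk h1 h2
    have := h (π k) (i, j) (mem_desc.2 ⟨hij, h1.trans h2⟩) h1 h2
    simp only [Equiv.symm_apply_apply] at this
    rw [Fin.lt_def] at *
    omega

theorem mem_db {π : Equiv.Perm (Fin n)} {v : Fin n} : v ∈ db π ↔ ∃ p ∈ desc π, π p.2 = v := by
  simp only [db, Finset.mem_filter, Finset.mem_univ, true_and, mem_desc, Prod.exists]
  exact ⟨fun ⟨i, j, h1, h2, h3⟩ => ⟨i, j, ⟨h1, h2⟩, h3.symm⟩,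
    fun ⟨i, j, ⟨h1, h2⟩, h3⟩ => ⟨i, j, h1, h2, h3.symm⟩⟩

theorem mem_dt {π : Equiv.Perm (Fin n)} {v : Fin n} : v ∈ dt π ↔ ∃ p ∈ desc π, π p.1 = v := by
  simp only [dt, Finset.mem_filter, Finset.mem_univ, true_and, mem_desc, Prod.exists]
  exact ⟨fun ⟨i, j, h1, h2, h3⟩ => ⟨i, j, ⟨h1, h2⟩, h3.symm⟩,
    fun ⟨i, j, ⟨h1, h2⟩, h3⟩ => ⟨i, j, h1, h2, h3.symm⟩⟩

theorem desc_eq_of_snd {π : Equiv.Perm (Fin n)} {p q : Fin n × Fin n} (hp : p ∈ desc π)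
    (hq : q ∈ desc π) (h : π p.2 = π q.2) : p = q := by
  rw [mem_desc] at hp hq
  have := π.injective h
  ext
  · have := congrArg Fin.val this; omega
  · rw [this]

theorem desc_eq_of_fst {π : Equiv.Perm (Fin n)} {p q : Fin n × Fin n} (hp : p ∈ desc π)
    (hq : q ∈ desc π) (h : π p.1 = π q.1) : p = q := by
  rw [mem_desc] at hp hq
  have := π.injective h
  ext
  · rw [this]
  · have := congrArg Fin.val this; omega

theorem card_db_filter (π : Equiv.Perm (Fin n)) (P : Fin n → Prop) [DecidablePred P] :
    ((db π).filter P).card = ((desc π).filter fun p => P (π p.2)).card := by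
  symm
  refine Finset.card_bij (fun p _ => π p.2) ?_ ?_ ?_
  · intro p hp
    rw [Finset.mem_filter] at *
    exact ⟨mem_db.2 ⟨p, hp.1, rfl⟩, hp.2⟩
  · intro p hp q hq h
    exact desc_eq_of_snd (Finset.mem_filter.1 hp).1 (Finset.mem_filter.1 hq).1 h
  · intro v hv
    rw [Finset.mem_filter, mem_db] at hv
    obtain ⟨⟨p, hp, rfl⟩, hv⟩ := hv
    exact ⟨p, Finset.mem_filter.2 ⟨hp, hv⟩, rfl⟩

theorem card_dt_filter (π : Equiv.Perm (Fin n)) (P : Fin n → Prop) [DecidablePred P] :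
    ((dt π).filter P).card = ((desc π).filter fun p => P (π p.1)).card := by
  symm
  refine Finset.card_bij (fun p _ => π p.1) ?_ ?_ ?_
  · intro p hp
    rw [Finset.mem_filter] at *
    exact ⟨mem_dt.2 ⟨p, hp.1, rfl⟩, hp.2⟩
  · intro p hp q hq h
    exact desc_eq_of_fst (Finset.mem_filter.1 hp).1 (Finset.mem_filter.1 hq).1 h
  · intro v hv
    rw [Finset.mem_filter, mem_dt] at hv
    obtain ⟨⟨p, hp, rfl⟩, hv⟩ := hv
    exact ⟨p, Finset.mem_filter.2 ⟨hp, hv⟩, rfl⟩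

/-- A descent whose top exceeds `a` either has its bottom at least `a` or encloses `a`. -/
theorem card_dt_gt (π : Equiv.Perm (Fin n)) (a : Fin n) :
    ((dt π).filter fun b => a < b).card = ((db π).filter fun b => a ≤ b).card + cross π a := by
  rw [card_dt_filter, card_db_filter, cross, ← Finset.card_union_of_disjoint]
  · congr 1
    ext p
    simp only [Finset.mem_filter, Finset.mem_union, mem_desc]
    constructor
    · rintro ⟨h1, h2⟩
      rcases lt_or_ge (π p.2) a with h | h
      · exact Or.inr ⟨h1, h, h2⟩
      · exact Or.inl ⟨h1, h⟩
    · rintro (⟨h1, h2⟩ | ⟨h1, h2, h3⟩)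
      · exact ⟨h1, h2.trans_lt h1.2⟩
      · exact ⟨h1, h3⟩
  · rw [Finset.disjoint_left]
    intro p hp hq
    simp only [Finset.mem_filter] at hp hq
    exact absurd hq.2.1 (not_lt.2 hp.2)

theorem mem_wexb {π : Equiv.Perm (Fin n)} {x : Fin n} :
    x ∈ wexb π ↔ (∃ a ∈ db π, (x : ℕ) = a + 1) ∨ (x : ℕ) = 0 := by simp [wexb]

theorem mem_wext {π : Equiv.Perm (Fin n)} {x : Fin n} :
    x ∈ wext π ↔ (∃ a ∈ dt π, (x : ℕ) + 1 = a) ∨ (x : ℕ) + 1 = n := by simp [wext]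

theorem lt_last_of_mem_db {π : Equiv.Perm (Fin n)} {a : Fin n} (h : a ∈ db π) :
    (a : ℕ) + 1 < n := by
  obtain ⟨p, hp, rfl⟩ := mem_db.1 h
  have := (mem_desc.1 hp).2
  rw [Fin.lt_def] at this
  omega

theorem pos_of_mem_dt {π : Equiv.Perm (Fin n)} {a : Fin n} (h : a ∈ dt π) : 0 < (a : ℕ) := by
  obtain ⟨p, hp, rfl⟩ := mem_dt.1 h
  have := (mem_desc.1 hp).2
  rw [Fin.lt_def] at this
  omega

theorem nwext_eq (π : Equiv.Perm (Fin n)) : nwext π = (wexb π)ᶜ := by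
  ext x
  simp only [nwext, ndt, Finset.mem_filter, Finset.mem_univ, true_and, Finset.mem_compl, mem_wexb]
  constructor
  · rintro ⟨a, h1, h2⟩ (⟨b, h3, h4⟩ | h3)
    · have : a = b := Fin.ext (by omega)
      exact h1 (this ▸ h3)
    · omega
  · intro h
    push Not at h
    refine ⟨⟨x - 1, by omega⟩, fun h' => h.1 _ h' ?_, ?_⟩ <;> simp only <;> omega

theorem nwexb_eq (π : Equiv.Perm (Fin n)) : nwexb π = (wext π)ᶜ := by
  ext x
  simp only [nwexb, ndb, Finset.mem_filter, Finset.mem_univ, true_and, Finset.mem_compl, mem_wext]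
  constructor
  · rintro ⟨a, h1, h2⟩ (⟨b, h3, h4⟩ | h3)
    · have : a = b := Fin.ext (by omega)
      exact h1 (this ▸ h3)
    · omega
  · intro h
    push Not at h
    refine ⟨⟨x + 1, by omega⟩, fun h' => h.1 _ h' ?_, ?_⟩ <;> simp only

theorem card_wexb_gt (π : Equiv.Perm (Fin n)) (a : Fin n) :
    ((wexb π).filter fun x => a < x).card = ((db π).filter fun b => a ≤ b).card := by
  symm
  refine Finset.card_bij (fun b hb => ⟨b + 1, lt_last_of_mem_db (Finset.mem_filter.1 hb).1⟩) ?_ ?_ ?_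
  · intro b hb
    rw [Finset.mem_filter] at *
    exact ⟨mem_wexb.2 (Or.inl ⟨b, hb.1, rfl⟩), Nat.lt_succ_of_le hb.2⟩
  · intro b _ c _ h
    simpa [Fin.ext_iff] using h
  · intro x hx
    rw [Finset.mem_filter, mem_wexb, Fin.lt_def] at hx
    obtain ⟨⟨b, hb, hx⟩ | hx, h⟩ := hx
    · exact ⟨b, Finset.mem_filter.2 ⟨hb, Fin.le_def.2 (by omega)⟩, Fin.ext hx.symm⟩
    · omega

theorem card_wext_ge (π : Equiv.Perm (Fin n)) (a : Fin n) :
    ((wext π).filter fun x => a ≤ x).card = ((dt π).filter fun b => a < b).card + 1 := by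
  have hn : n - 1 < n := by have := a.2; omega
  have : (wext π).filter (fun x => a ≤ x) =
      insert ⟨n - 1, hn⟩ (((dt π).filter fun b => a < b).image
        fun b : Fin n => (⟨b - 1, by have := b.2; omega⟩ : Fin n)) := by
    ext x
    simp only [Finset.mem_filter, mem_wext, Finset.mem_insert, Finset.mem_image, Fin.ext_iff,
      Fin.le_def, Fin.lt_def]
    constructor
    · rintro ⟨⟨b, hb, h⟩ | h, h'⟩
      · exact Or.inr ⟨b, ⟨hb, by omega⟩, by omega⟩
      · exact Or.inl (by omega)
    · rintro (h | ⟨b, ⟨hb, h⟩, h'⟩)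
      · exact ⟨Or.inr (by omega), by omega⟩
      · exact ⟨Or.inl ⟨b, hb, by omega⟩, by omega⟩
  rw [this, Finset.card_insert_of_notMem, Finset.card_image_of_injOn]
  · intro b hb c hc h
    have h1 := pos_of_mem_dt (Finset.mem_filter.1 hb).1
    have h2 := pos_of_mem_dt (Finset.mem_filter.1 hc).1
    simp only [Fin.ext_iff] at h ⊢
    omega
  · simp only [Finset.mem_image, Finset.mem_filter, Fin.ext_iff, not_exists, not_and]
    intro b hb h
    have h1 := pos_of_mem_dt hb.1
    omega

/-- When `a` is processed, the positions in `wexb π` above `a` have each used one value; this leaves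
`cross π a + 1` candidates, at least `remb π a + 1`. The final 1 is the largest element, which
always belongs to `wext π`. -/
theorem card_wext_ge_eq (π : Equiv.Perm (Fin n)) (a : Fin n) :
    ((wext π).filter fun x => a ≤ x).card =
      ((wexb π).filter fun x => a < x).card + cross π a + 1 := by
  rw [card_wext_ge, card_dt_gt, card_wexb_gt]

theorem card_wext_eq (π : Equiv.Perm (Fin n)) : (wext π).card = (wexb π).card := by
  rcases n with _ | n
  · simp [Finset.eq_empty_of_isEmpty]
  -- At 0 the filter on `wext π` is vacuous and no descent encloses 0. The summand 1 makes up for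
  -- the element 0 of `wexb π`, which the strict inequality omits.
  have h := card_wext_ge_eq π 0
  have h1 : (wext π).filter (fun x => 0 ≤ x) = wext π := by
    rw [Finset.filter_eq_self]; simp
  have h2 : (wexb π).filter (fun x => 0 < x) = (wexb π).erase 0 := by
    ext x
    simp only [Finset.mem_filter, Finset.mem_erase, Fin.pos_iff_ne_zero]
    tauto
  have h3 : (0 : Fin (n + 1)) ∈ wexb π := mem_wexb.2 (Or.inr rfl)
  have h4 : cross π 0 = 0 := by
    rw [cross, Finset.card_eq_zero, Finset.filter_eq_empty_iff]
    intro p _ h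
    exact absurd h.1 (Fin.not_lt_zero _)
  rw [h1, h2, Finset.card_erase_of_mem h3, h4] at h
  have : 0 < (wexb π).card := Finset.card_pos.2 ⟨_, h3⟩
  omega

theorem card_filter_add_card_compl_filter (s : Finset (Fin n)) (P : Fin n → Prop)
    [DecidablePred P] :
    (s.filter P).card + (sᶜ.filter P).card = (Finset.univ.filter P).card := by
  rw [← Finset.card_union_of_disjoint, ← Finset.filter_union, Finset.union_compl]
  exact Finset.disjoint_filter_filter disjoint_compl_right

/-- Complementary to `card_wext_ge_eq`, since `wexb π` and `wext π` have the same size. It provides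
the room in the second phase. -/
theorem card_nwexb_lt_eq (π : Equiv.Perm (Fin n)) {c : Fin n} (hc : c ∉ wexb π) :
    ((nwexb π).filter fun x => x < c).card =
      ((nwext π).filter fun x => x < c).card + cross π c + 1 := by
  have h1 := card_filter_add_card_compl_filter (wext π) fun x => x < c
  have h2 := card_filter_add_card_compl_filter (wexb π) fun x => x < c
  have h3 := card_wext_ge_eq π c
  have h4 := Finset.card_filter_add_card_filter_not (s := wext π) fun x => x < c
  have h5 := Finset.card_filter_add_card_filter_not (s := wexb π) fun x => x < c
  have h6 : (wext π).filter (fun x => ¬ x < c) = (wext π).filter fun x => c ≤ x :=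
    Finset.filter_congr fun x _ => not_lt
  have h7 : (wexb π).filter (fun x => ¬ x < c) = (wexb π).filter fun x => c < x :=
    Finset.filter_congr fun x hx =>
      ⟨fun h => lt_of_le_of_ne (not_lt.1 h) fun h' => hc (h' ▸ hx), fun h => not_lt.2 h.le⟩
  rw [← nwexb_eq] at h1
  rw [← nwext_eq] at h2
  rw [h6] at h4
  rw [h7] at h5
  have := card_wext_eq π
  omega

end SteinWil

/-! ### The permutation Ψ(π), the statistics of π read off from it, and 3-2-1. -/

namespace SteinWil

variable {n : ℕ}

theorem psiFun_wex (π : Equiv.Perm (Fin n)) :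
    (∀ a ∈ wexb π, psiFun π a ∈ wext π ∧ a ≤ psiFun π a) ∧
    (∀ a ∈ wexb π, ∀ b ∈ wexb π, psiFun π a = psiFun π b → a = b) ∧
    (∀ a ∈ wexb π, remb π a = ((wext π).filter fun b => a ≤ b ∧
      (∀ x ∈ wexb π, a < x → psiFun π x ≠ b) ∧ b < psiFun π a).card) := by
  have h := assign_spec (n := n) (· ≤ ·) (· < ·) (fun a b => b < a) (· ≤ ·)
    (fun a b => lt_iff_le_and_ne) (fun a b h => lt_asymm h) (fun a x b h h' => h.le.trans h')
    (remb π) (pickWex π) (fun a T => rfl) ((wexb π).sort (· ≥ ·)) (wext π)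
    ((Finset.sortedGT_sort _).pairwise)
    (fun a _ => by
      have h1 := card_wext_ge_eq π a
      have h2 := remb_le_cross π a
      rw [Finset.sort_toFinset]
      omega)
  simp only [Finset.mem_sort] at h
  have e : ∀ a ∈ wexb π,
      assign (pickWex π) ((wexb π).sort (· ≥ ·)) (wext π) a = psiFun π a :=
    fun a ha => by rw [psiFun, if_pos ha]
  obtain ⟨h1, h2, h3⟩ := h
  refine ⟨fun a ha => e a ha ▸ h1 a ha, fun a ha b hb => e a ha ▸ e b hb ▸ h2 a ha b hb, ?_⟩
  intro a ha
  rw [h3 a ha, e a ha]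
  congr 1
  refine Finset.filter_congr fun b _ => and_congr_right fun _ => and_congr_left fun _ => ?_
  exact forall₂_congr fun x hx => by rw [e x hx]

theorem psiFun_nwex (π : Equiv.Perm (Fin n)) :
    (∀ a ∉ wexb π, psiFun π a ∉ wext π ∧ psiFun π a < a) ∧
    (∀ a ∉ wexb π, ∀ b ∉ wexb π, psiFun π a = psiFun π b → a = b) ∧
    (∀ a ∉ wexb π, remb π a = ((wext π)ᶜ.filter fun b => b < a ∧
      (∀ x ∉ wexb π, x < a → psiFun π x ≠ b) ∧ psiFun π a < b).card) := by
  have h := assign_spec (n := n) (· ≥ ·) (· > ·) (· < ·) (fun a b => b < a)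
    (fun a b => lt_iff_le_and_ne.trans (and_congr_right' ne_comm)) (fun a b h => lt_asymm h)
    (fun a x b h h' => lt_trans h' h)
    (remb π) (pickNwex π) (fun a T => rfl) ((nwext π).sort (· ≤ ·)) (nwexb π)
    ((Finset.sortedLT_sort _).pairwise)
    (fun a ha => by
      rw [Finset.mem_sort, nwext_eq, Finset.mem_compl] at ha
      have h1 := card_nwexb_lt_eq π ha
      have h2 := remb_le_cross π a
      rw [Finset.sort_toFinset]
      omega)
  have e : ∀ a ∉ wexb π,
      assign (pickNwex π) ((nwext π).sort (· ≤ ·)) (nwexb π) a = psiFun π a :=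
    fun a ha => by rw [psiFun, if_neg ha]
  simp only [Finset.mem_sort] at h
  obtain ⟨h1, h2, h3⟩ := h
  have m : ∀ a, a ∈ nwext π ↔ a ∉ wexb π := fun a => by rw [nwext_eq, Finset.mem_compl]
  simp only [m] at h1 h2 h3
  rw [← nwexb_eq]
  refine ⟨fun a ha => ?_, fun a ha b hb => e a ha ▸ e b hb ▸ h2 a ha b hb, ?_⟩
  · have := h1 a ha
    rw [e a ha] at this
    rwa [nwexb_eq, Finset.mem_compl] at this
  intro a ha
  rw [h3 a ha, e a ha]
  congr 1
  refine Finset.filter_congr fun b _ => and_congr_right fun _ => and_congr_left fun _ => ?_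
  exact forall₂_congr fun x hx => by rw [e x hx]

theorem mem_wexb_iff_le (π : Equiv.Perm (Fin n)) (a : Fin n) : a ∈ wexb π ↔ a ≤ psiFun π a :=
  ⟨fun h => ((psiFun_wex π).1 a h).2, fun h => by
    by_contra h'
    exact absurd ((psiFun_nwex π).1 a h').2 (not_lt.2 h)⟩

theorem mem_wexb_iff_mem_wext (π : Equiv.Perm (Fin n)) (a : Fin n) :
    a ∈ wexb π ↔ psiFun π a ∈ wext π :=
  ⟨fun h => ((psiFun_wex π).1 a h).1, fun h => by
    by_contra h'
    exact absurd h ((psiFun_nwex π).1 a h').1⟩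

theorem psiFun_injective (π : Equiv.Perm (Fin n)) : Function.Injective (psiFun π) := by
  intro a b h
  by_cases ha : a ∈ wexb π
  · have hb : b ∈ wexb π := by
      rw [mem_wexb_iff_mem_wext] at *
      rwa [← h]
    exact (psiFun_wex π).2.1 a ha b hb h
  · have hb : b ∉ wexb π := by
      rw [mem_wexb_iff_mem_wext] at *
      rwa [← h]
    exact (psiFun_nwex π).2.1 a ha b hb h

/-- The map `Ψ`. -/
noncomputable def psi (π : Equiv.Perm (Fin n)) : Equiv.Perm (Fin n) :=
  Equiv.ofBijective (psiFun π) (Finite.injective_iff_bijective.1 (psiFun_injective π))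

theorem psi_apply (π : Equiv.Perm (Fin n)) (i : Fin n) : psi π i = psiFun π i := rfl

theorem mem_wexb_iff_le_psi (π : Equiv.Perm (Fin n)) (a : Fin n) : a ∈ wexb π ↔ a ≤ psi π a :=
  mem_wexb_iff_le π a

theorem mem_wexb_iff_psi_mem (π : Equiv.Perm (Fin n)) (a : Fin n) :
    a ∈ wexb π ↔ psi π a ∈ wext π :=
  mem_wexb_iff_mem_wext π a

theorem card_filter_perm (σ : Equiv.Perm (Fin n)) (s : Finset (Fin n)) (P : Fin n → Prop)
    [DecidablePred P] :
    (s.filter P).card = (Finset.univ.filter fun x => σ x ∈ s ∧ P (σ x)).card := by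
  symm
  refine Finset.card_bij (fun x _ => σ x) ?_ (fun _ _ _ _ h => σ.injective h) ?_
  · intro x hx
    simpa using hx
  · intro b hb
    exact ⟨σ.symm b, by simpa using hb, by simp⟩

/-- The greedy rank of the chosen value is rewritten through preimages. A value still available at
step `a` is not taken by a larger position; if it is smaller than the value of `a`, it belongs to a
position x < a, which is automatically a weak excedance as its value is at least `a`. -/
theorem remb_wex (π : Equiv.Perm (Fin n)) {a : Fin n} (ha : a ≤ psi π a) :
    remb π a = (Finset.univ.filter fun x => x < a ∧ a ≤ psi π x ∧ psi π x < psi π a).card := by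
  rw [(psiFun_wex π).2.2 a ((mem_wexb_iff_le_psi π a).2 ha), card_filter_perm (psi π)]
  congr 1
  ext x
  simp only [Finset.mem_filter, Finset.mem_univ, true_and, ← psi_apply,
    ← mem_wexb_iff_psi_mem, mem_wexb_iff_le_psi]
  constructor
  · rintro ⟨h1, h2, h3, h4⟩
    refine ⟨lt_of_not_ge fun h => ?_, h2, h4⟩
    rcases h.eq_or_lt with rfl | h
    · exact lt_irrefl _ h4
    · exact h3 x h1 h rfl
  · rintro ⟨h1, h2, h3⟩
    refine ⟨(h1.trans_le h2).le, h2, fun y _ h5 h6 => ?_, h3⟩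
    rw [(psi π).injective h6] at h5
    exact lt_asymm h1 h5

theorem remb_nwex (π : Equiv.Perm (Fin n)) {a : Fin n} (ha : psi π a < a) :
    remb π a = (Finset.univ.filter fun x => a < x ∧ psi π x < a ∧ psi π a < psi π x).card := by
  have m : ∀ x, x ∉ wexb π ↔ psi π x < x := fun x => by rw [mem_wexb_iff_le_psi, not_le]
  rw [(psiFun_nwex π).2.2 a ((m a).2 ha), card_filter_perm (psi π)]
  congr 1
  ext x
  simp only [Finset.mem_filter, Finset.mem_univ, true_and, ← psi_apply, Finset.mem_compl,
    ← mem_wexb_iff_psi_mem, m]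
  constructor
  · rintro ⟨h1, h2, h3, h4⟩
    refine ⟨lt_of_not_ge fun h => ?_, h2, h4⟩
    rcases h.eq_or_lt with rfl | h
    · exact lt_irrefl _ h4
    · exact h3 x h1 h rfl
  · rintro ⟨h1, h2, h3⟩
    refine ⟨h2.trans h1, h2, fun y _ h5 h6 => ?_, h3⟩
    rw [(psi π).injective h6] at h5
    exact lt_asymm h1 h5

/-- The elements of `wext π` that are at least `a` are split by their preimages: all weak excedances
above `a`, the position `a` itself, and the positions x < a counted here. Comparison with
`card_wext_ge_eq` leaves `cross π a`. -/
theorem cross_wex (π : Equiv.Perm (Fin n)) {a : Fin n} (ha : a ≤ psi π a) :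
    cross π a = (Finset.univ.filter fun x => x < a ∧ a ≤ psi π x).card := by
  have h := card_wext_ge_eq π a
  rw [card_filter_perm (psi π)] at h
  have : (Finset.univ.filter fun x => psi π x ∈ wext π ∧ a ≤ psi π x) =
      ((wexb π).filter fun x => a < x) ∪
        insert a (Finset.univ.filter fun x => x < a ∧ a ≤ psi π x) := by
    ext x
    simp only [Finset.mem_filter, Finset.mem_univ, true_and, Finset.mem_union, Finset.mem_insert,
      ← mem_wexb_iff_psi_mem, mem_wexb_iff_le_psi]
    constructor
    · rintro ⟨h1, h2⟩
      rcases lt_trichotomy x a with h | h | h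
      · exact Or.inr (Or.inr ⟨h, h2⟩)
      · exact Or.inr (Or.inl h)
      · exact Or.inl ⟨h1, h⟩
    · rintro (⟨h1, h2⟩ | rfl | ⟨h1, h2⟩)
      · exact ⟨h1, h2.le.trans h1⟩
      · exact ⟨ha, ha⟩
      · exact ⟨h1.le.trans h2, h2⟩
  rw [this, Finset.card_union_of_disjoint, Finset.card_insert_of_notMem (by simp)] at h
  · omega
  · rw [Finset.disjoint_left]
    intro x hx hx'
    simp only [Finset.mem_filter, Finset.mem_univ, true_and, Finset.mem_insert] at hx hx'
    rcases hx' with rfl | hx'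
    · exact lt_irrefl _ hx.2
    · exact lt_asymm hx.2 hx'.1

theorem cross_nwex (π : Equiv.Perm (Fin n)) {a : Fin n} (ha : psi π a < a) :
    cross π a = (Finset.univ.filter fun x => a < x ∧ psi π x < a).card := by
  have m : ∀ x, x ∉ wexb π ↔ psi π x < x := fun x => by rw [mem_wexb_iff_le_psi, not_le]
  have h := card_nwexb_lt_eq π ((m a).2 ha)
  rw [card_filter_perm (psi π)] at h
  have : (Finset.univ.filter fun x => psi π x ∈ nwexb π ∧ psi π x < a) =
      ((nwext π).filter fun x => x < a) ∪
        insert a (Finset.univ.filter fun x => a < x ∧ psi π x < a) := by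
    ext x
    simp only [Finset.mem_filter, Finset.mem_univ, true_and, Finset.mem_union, Finset.mem_insert,
      nwexb_eq, nwext_eq, Finset.mem_compl, ← mem_wexb_iff_psi_mem, m]
    constructor
    · rintro ⟨h1, h2⟩
      rcases lt_trichotomy x a with h | h | h
      · exact Or.inl ⟨h1, h⟩
      · exact Or.inr (Or.inl h)
      · exact Or.inr (Or.inr ⟨h, h2⟩)
    · rintro (⟨h1, h2⟩ | rfl | ⟨h1, h2⟩)
      · exact ⟨h1, h1.trans h2⟩
      · exact ⟨ha, ha⟩
      · exact ⟨h2.trans h1, h2⟩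
  rw [this, Finset.card_union_of_disjoint, Finset.card_insert_of_notMem (by simp)] at h
  · omega
  · rw [Finset.disjoint_left]
    intro x hx hx'
    simp only [Finset.mem_filter, Finset.mem_univ, true_and, Finset.mem_insert] at hx hx'
    rcases hx' with rfl | hx'
    · exact lt_irrefl _ hx.2
    · exact lt_asymm hx.2 hx'.1

/-- Pigeonhole: otherwise all `σ a` values below `σ a` sit at positions at most `a` other than `a`
and `x`. There are only `a - 1` of these, whereas `a ≤ σ a`. -/
theorem exists_gt_apply_lt (σ : Equiv.Perm (Fin n)) {x a : Fin n} (hx : x < a) (ha : a ≤ σ a)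
    (h : σ a < σ x) : ∃ k, a < k ∧ σ k < σ a := by
  by_contra! hk
  have h1 : (Finset.Iio (σ a)).map σ.symm.toEmbedding ⊆ ((Finset.Iic a).erase a).erase x := by
    intro y hy
    simp only [Finset.mem_map_equiv, Equiv.symm_symm, Finset.mem_Iio] at hy
    simp only [Finset.mem_erase, Finset.mem_Iic]
    refine ⟨?_, ?_, ?_⟩
    · rintro rfl; exact lt_asymm h hy
    · rintro rfl; exact lt_irrefl _ hy
    · by_contra hay
      exact absurd hy (not_lt.2 (hk y (not_le.1 hay)))
  have h2 := Finset.card_le_card h1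
  rw [Finset.card_map, Finset.card_erase_of_mem, Finset.card_erase_of_mem] at h2
  · simp only [Fin.card_Iio, Fin.card_Iic] at h2
    rw [Fin.le_def] at ha
    rw [Fin.lt_def] at hx
    omega
  · simp
  · simpa using hx

/-- Pigeonhole: the `c` positions before `c` cannot all have values below `σ c`, as `σ c < c`. -/
theorem exists_lt_lt_apply (σ : Equiv.Perm (Fin n)) {c : Fin n} (hc : σ c < c) :
    ∃ k, k < c ∧ σ c < σ k := by
  by_contra! hk
  have h1 : (Finset.Iio c).map σ.toEmbedding ⊆ Finset.Iio (σ c) := by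
    intro y hy
    simp only [Finset.mem_map, Equiv.coe_toEmbedding, Finset.mem_Iio] at hy ⊢
    obtain ⟨x, hx, rfl⟩ := hy
    exact lt_of_le_of_ne (hk x hx) fun h => hx.ne (σ.injective h)
  have h2 := Finset.card_le_card h1
  rw [Finset.card_map] at h2
  simp only [Fin.card_Iio] at h2
  exact absurd hc (not_lt.2 h2)

/-- A permutation avoids `3-2-1` if and only if it increases on its weak excedances and on the
other positions. -/
theorem mem_avoiders_321_iff (σ : Equiv.Perm (Fin n)) :
    σ ∈ avoiders n pat3_2_1 ↔ (∀ x a, x < a → a ≤ σ a → σ x ≤ σ a) ∧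
      (∀ c x, c < x → σ c < c → σ x < c → σ c ≤ σ x) := by
  rw [mem_avoiders_pat3_2_1]
  constructor
  · intro h
    constructor
    · intro x a hx ha
      by_contra hlt
      rw [not_le] at hlt
      obtain ⟨k, hk, hk'⟩ := exists_gt_apply_lt σ hx ha hlt
      exact h x a k hx hk hk' hlt
    · intro c x hcx hc hxc
      by_contra hlt
      rw [not_le] at hlt
      obtain ⟨k, hk, hk'⟩ := exists_lt_lt_apply σ hc
      exact h k c x hk hcx hlt hk'
  · rintro ⟨h1, h2⟩ i j k hij hjk hkj hji
    rcases le_or_gt j (σ j) with h | h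
    · exact absurd hji (not_lt.2 (h1 i j hij h))
    · exact absurd hkj (not_lt.2 (h2 j k hjk h (hkj.trans h)))

/-- `remb` and `cross` count nested sets of positions of the image, so their equality at `a` means
that the order condition defining the smaller set holds throughout the larger one. -/
theorem psi_mem_avoiders_iff (π : Equiv.Perm (Fin n)) :
    psi π ∈ avoiders n pat3_2_1 ↔ π ∈ avoiders n pat31_2 := by
  rw [mem_avoiders_iff_remb_eq_cross, mem_avoiders_321_iff]
  have hw : ∀ a, a ≤ psi π a →
      (remb π a = cross π a ↔ ∀ x, x < a → a ≤ psi π x → psi π x < psi π a) := by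
    intro a ha
    rw [remb_wex π ha, cross_wex π ha]
    simp_rw [← and_assoc]
    rw [← Finset.filter_filter, Finset.card_filter_eq_iff]
    simp
  have hn : ∀ a, psi π a < a →
      (remb π a = cross π a ↔ ∀ x, a < x → psi π x < a → psi π a < psi π x) := by
    intro a ha
    rw [remb_nwex π ha, cross_nwex π ha]
    simp_rw [← and_assoc]
    rw [← Finset.filter_filter, Finset.card_filter_eq_iff]
    simp
  constructor
  · rintro ⟨h1, h2⟩ a
    rcases le_or_gt a (psi π a) with ha | ha
    · exact (hw a ha).2 fun x hx _ =>
        lt_of_le_of_ne (h1 x a hx ha) fun h => hx.ne ((psi π).injective h)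
    · exact (hn a ha).2 fun x hx hxa =>
        lt_of_le_of_ne (h2 a x hx ha hxa) fun h => hx.ne ((psi π).injective h)
  · intro h
    constructor
    · intro x a hx ha
      rcases le_or_gt a (psi π x) with hxa | hxa
      · exact ((hw a ha).1 (h a) x hx hxa).le
      · exact hxa.le.trans ha
    · intro c x hcx hc hxc
      exact ((hn c hc).1 (h c) x hcx hxc).le

end SteinWil

/-! ### Injectivity of Ψ: reconstruction of π by inserting its entries in increasing order. -/

namespace SteinWil

variable {n : ℕ}

/-- The descent bottoms less than `k` whose predecessor is at least `k`. -/
def active (π : Equiv.Perm (Fin n)) (k : ℕ) : Finset (Fin n) :=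
  Finset.univ.filter fun v => ∃ p ∈ desc π, π p.2 = v ∧ (v : ℕ) < k ∧ k ≤ π p.1

theorem mem_active {π : Equiv.Perm (Fin n)} {k : ℕ} {v : Fin n} :
    v ∈ active π k ↔ ∃ p ∈ desc π, π p.2 = v ∧ (v : ℕ) < k ∧ k ≤ π p.1 := by
  simp only [active, Finset.mem_filter, Finset.mem_univ, true_and]

/-- The elements of `active π a` to the right of the entry `a`. -/
def activeAfter (π : Equiv.Perm (Fin n)) (a : Fin n) : Finset (Fin n) :=
  (active π a).filter fun v => π.symm a < π.symm v

theorem mem_activeAfter {π : Equiv.Perm (Fin n)} {a v : Fin n} :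
    v ∈ activeAfter π a ↔ v ∈ active π a ∧ π.symm a < π.symm v := Finset.mem_filter

/-- A descent to the right with bottom below `a` and top above `a` is a 2-31 starting with `a`; the
only further contribution is the descent with top `a`, if there is one. -/
theorem card_activeAfter (π : Equiv.Perm (Fin n)) (a : Fin n) :
    (activeAfter π a).card = remb π a + if a ∈ dt π then 1 else 0 := by
  have h1 : (activeAfter π a).card =
      ((desc π).filter fun p => (π p.2 < a ∧ a ≤ π p.1) ∧ π.symm a < p.2).card := by
    symm
    refine Finset.card_bij (fun p _ => π p.2) ?_ ?_ ?_
    · intro p hp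
      rw [Finset.mem_filter] at hp
      exact mem_activeAfter.2 ⟨mem_active.2 ⟨p, hp.1, rfl, hp.2.1.1, hp.2.1.2⟩, by simpa using hp.2.2⟩
    · intro p hp q hq h
      exact desc_eq_of_snd (Finset.mem_filter.1 hp).1 (Finset.mem_filter.1 hq).1 h
    · intro v hv
      rw [mem_activeAfter, mem_active] at hv
      obtain ⟨⟨p, hp, rfl, h1, h2⟩, h3⟩ := hv
      exact ⟨p, Finset.mem_filter.2 ⟨hp, ⟨h1, h2⟩, by simpa using h3⟩, rfl⟩
  have h2 : (if a ∈ dt π then 1 else 0) = ((desc π).filter fun p => π p.1 = a).card := by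
    rw [← card_dt_filter π (fun b => b = a), Finset.filter_eq']
    split_ifs <;> simp
  rw [h1, h2, remb_eq, ← Finset.card_union_of_disjoint]
  · congr 1
    ext p
    simp only [Finset.mem_filter, Finset.mem_union, mem_desc]
    constructor
    · rintro ⟨⟨h1, h2⟩, ⟨h3, h4⟩, h5⟩
      rcases h4.eq_or_lt with h | h
      · exact Or.inr ⟨⟨h1, h2⟩, h.symm⟩
      · refine Or.inl ⟨⟨h1, h2⟩, ⟨h3, h⟩, ?_⟩
        have : π.symm a ≠ p.1 := fun h' => by rw [← h'] at h; simp at h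
        rw [Ne, Fin.ext_iff] at this
        rw [Fin.lt_def] at *
        omega
    · rintro (⟨⟨h1, h2⟩, ⟨h3, h4⟩, h5⟩ | ⟨⟨d1, d2⟩, rfl⟩)
      · refine ⟨⟨h1, h2⟩, ⟨h3, h4.le⟩, ?_⟩
        rw [Fin.lt_def] at *
        omega
      · refine ⟨⟨d1, d2⟩, ⟨d2, le_rfl⟩, ?_⟩
        rw [Equiv.symm_apply_apply, Fin.lt_def]
        omega
  · rw [Finset.disjoint_left]
    intro p hp hq
    simp only [Finset.mem_filter] at hp hq
    exact hp.2.1.2.ne' hq.2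

/-- The leftmost entry below `a` to the right of `a` has a predecessor that is at least `a`, hence
is active. So `activeAfter π a` fixes the place of `a` among the smaller entries. -/
theorem symm_lt_symm_iff_exists_activeAfter (π : Equiv.Perm (Fin n)) {a w : Fin n} (hw : w < a) :
    π.symm a < π.symm w ↔ ∃ v ∈ activeAfter π a, π.symm v ≤ π.symm w := by
  constructor
  · intro h
    obtain ⟨q, hq, hmin⟩ := Finset.exists_min_image
      (Finset.univ.filter fun q => π.symm a < q ∧ π q < a) id
      ⟨π.symm w, by simpa using ⟨h, hw⟩⟩
    simp only [Finset.mem_filter, Finset.mem_univ, true_and, id] at hq hmin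
    have hq0 : 0 < (q : ℕ) := lt_of_le_of_lt (Nat.zero_le _) (Fin.lt_def.1 hq.1)
    set q' : Fin n := ⟨q - 1, by omega⟩ with hq'
    have hq1 : a ≤ π q' := by
      by_contra hlt
      rw [not_le] at hlt
      have e : π.symm a ≠ q' := fun e => by rw [← e] at hlt; simp at hlt
      have := hmin q' ⟨?_, hlt⟩
      · rw [Fin.le_def] at this
        simp only [hq'] at this
        omega
      · have := hq.1
        rw [Ne, Fin.ext_iff] at e
        rw [Fin.lt_def] at *
        simp only [hq'] at *
        omega
    refine ⟨π q, mem_activeAfter.2 ⟨mem_active.2 ⟨(q', q), mem_desc.2 ⟨?_, hq.2.trans_le hq1⟩, rfl,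
      hq.2, hq1⟩, by simpa using hq.1⟩, ?_⟩
    · simp only [hq']; omega
    · simpa using hmin (π.symm w) ⟨h, by simpa using hw⟩
  · rintro ⟨v, hv, h⟩
    exact (mem_activeAfter.1 hv).2.trans_le h

/-- Raising the threshold past `a` can only add `a` itself and only remove the successor of `a`. If
`a` is a descent top, this successor is the leftmost element of `activeAfter π a`, a description
that uses only the relative order of smaller entries. -/
theorem mem_active_succ (π : Equiv.Perm (Fin n)) (a v : Fin n) :
    v ∈ active π (a + 1) ↔ (v = a ∧ a ∈ db π) ∨ (v ∈ active π a ∧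
      ¬ (a ∈ dt π ∧ v ∈ activeAfter π a ∧ ∀ u ∈ activeAfter π a, π.symm v ≤ π.symm u)) := by
  constructor
  · intro hv
    obtain ⟨p, hp, rfl, h1, h2⟩ := mem_active.1 hv
    rcases (Nat.lt_succ_iff.1 h1).eq_or_lt with h | h
    · exact Or.inl ⟨Fin.ext h, mem_db.2 ⟨p, hp, Fin.ext h⟩⟩
    · refine Or.inr ⟨mem_active.2 ⟨p, hp, rfl, h, by omega⟩, ?_⟩
      rintro ⟨h3, h4, h5⟩
      obtain ⟨q, hq, rfl⟩ := mem_dt.1 h3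
      have hq' := mem_desc.1 hq
      have h6 := h5 (π q.2) (mem_activeAfter.2 ⟨mem_active.2 ⟨q, hq, rfl, hq'.2, le_rfl⟩, by
        simp only [Equiv.symm_apply_apply, Fin.lt_def]; omega⟩)
      have h7 := (mem_activeAfter.1 h4).2
      simp only [Equiv.symm_apply_apply, Fin.lt_def, Fin.le_def] at h6 h7
      have h8 : p.2 = q.2 := Fin.ext (by omega)
      have h9 := desc_eq_of_snd hp hq (by rw [h8])
      rw [h9] at h2
      omega
  · rintro (⟨rfl, h⟩ | ⟨h1, h2⟩)
    · obtain ⟨p, hp, h⟩ := mem_db.1 h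
      have := (mem_desc.1 hp).2
      rw [h] at this
      exact mem_active.2 ⟨p, hp, h, Nat.lt_succ_self _, this⟩
    · obtain ⟨p, hp, rfl, h3, h4⟩ := mem_active.1 h1
      refine mem_active.2 ⟨p, hp, rfl, by omega, ?_⟩
      by_contra h5
      have h6 : π p.1 = a := Fin.ext (by omega)
      have h7 := (mem_desc.1 hp).1
      refine h2 ⟨mem_dt.2 ⟨p, hp, h6⟩, mem_activeAfter.2 ⟨h1, ?_⟩, ?_⟩
      · rw [← h6]
        simp only [Equiv.symm_apply_apply, Fin.lt_def]
        omega
      · intro u hu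
        have := (mem_activeAfter.1 hu).2
        rw [← h6] at this
        simp only [Equiv.symm_apply_apply, Fin.lt_def, Fin.le_def] at this ⊢
        omega

/-- The relative order of the entries less than `k`, and the active ones among them, agree. -/
def AgreeBelow (π ρ : Equiv.Perm (Fin n)) (k : ℕ) : Prop :=
  (∀ u v : Fin n, (u : ℕ) < k → (v : ℕ) < k →
    (π.symm u < π.symm v ↔ ρ.symm u < ρ.symm v)) ∧ active π k = active ρ k

/-- Both sets are final segments of the same active set in the same left-to-right order, and
`card_activeAfter` gives them the same size. -/
theorem AgreeBelow.activeAfter_eq {π ρ : Equiv.Perm (Fin n)} {a : Fin n} (h : AgreeBelow π ρ a)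
    (hdt : dt π = dt ρ) (hr : ∀ a, remb π a = remb ρ a) : activeAfter π a = activeAfter ρ a := by
  have hcard : (activeAfter π a).card = (activeAfter ρ a).card := by
    rw [card_activeAfter, card_activeAfter, hdt, hr]
  have key : ∀ v v', v ∈ activeAfter π a → v ∉ activeAfter ρ a → v' ∈ activeAfter ρ a →
      v' ∈ activeAfter π a := by
    intro v v' h1 h2 h3
    rw [mem_activeAfter] at *
    rw [← h.2] at *
    refine ⟨h3.1, ?_⟩
    have h4 : ρ.symm v ≤ ρ.symm a := by
      rw [← not_lt]; exact fun h => h2 ⟨h1.1, h⟩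
    obtain ⟨_, _, _, l1, _⟩ := mem_active.1 h1.1
    obtain ⟨_, _, _, l2, _⟩ := mem_active.1 h3.1
    exact h1.2.trans ((h.1 v v' l1 l2).2 (h4.trans_lt h3.2))
  by_cases hs : activeAfter π a ⊆ activeAfter ρ a
  · exact Finset.eq_of_subset_of_card_le hs hcard.ge
  · rw [Finset.not_subset] at hs
    obtain ⟨v, hv, hv'⟩ := hs
    exact (Finset.eq_of_subset_of_card_le (fun v' h3 => key v v' hv hv' h3) hcard.le).symm

theorem AgreeBelow.succ {π ρ : Equiv.Perm (Fin n)} {a : Fin n} (h : AgreeBelow π ρ a)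
    (hdb : db π = db ρ) (hdt : dt π = dt ρ) (hr : ∀ a, remb π a = remb ρ a) :
    AgreeBelow π ρ (a + 1) := by
  have hU := h.activeAfter_eq hdt hr
  have hlt : ∀ {v}, v ∈ activeAfter ρ a → v < a := fun hv => by
    obtain ⟨_, _, _, l1, _⟩ := mem_active.1 (mem_activeAfter.1 hv).1
    exact l1
  have hle : ∀ u v : Fin n, u < a → v < a →
      (π.symm u ≤ π.symm v ↔ ρ.symm u ≤ ρ.symm v) := fun u v hu hv => by
    rw [← not_lt, ← not_lt, h.1 v u hv hu]
  have ha : ∀ w : Fin n, w < a → (π.symm a < π.symm w ↔ ρ.symm a < ρ.symm w) := by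
    intro w hw
    rw [symm_lt_symm_iff_exists_activeAfter π hw, symm_lt_symm_iff_exists_activeAfter ρ hw, hU]
    exact exists_congr fun v => and_congr_right fun hv => hle v w (hlt hv) hw
  have ha' : ∀ w : Fin n, w < a → (π.symm w < π.symm a ↔ ρ.symm w < ρ.symm a) := by
    intro w hw
    have e1 : π.symm w ≠ π.symm a := fun e => hw.ne (π.symm.injective e)
    have e2 : ρ.symm w ≠ ρ.symm a := fun e => hw.ne (ρ.symm.injective e)
    rw [lt_iff_le_and_ne, lt_iff_le_and_ne, ← not_lt, ← not_lt, ha w hw]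
    simp [e1, e2]
  refine ⟨fun u v hu hv => ?_, ?_⟩
  · rcases (Nat.lt_succ_iff.1 hu).eq_or_lt with hu | hu <;>
      rcases (Nat.lt_succ_iff.1 hv).eq_or_lt with hv | hv
    · rw [Fin.ext hu, Fin.ext hv]; simp
    · rw [Fin.ext hu]; exact ha v hv
    · rw [Fin.ext hv]; exact ha' u hu
    · exact h.1 u v hu hv
  · ext v
    rw [mem_active_succ, mem_active_succ, hU, hdb, hdt, h.2]
    refine or_congr_right (and_congr_right fun _ => not_congr (and_congr_right fun _ =>
      and_congr_right fun hv => ?_))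
    exact forall₂_congr fun u hu => hle v u (hlt hv) (hlt hu)

theorem eq_of_db_dt_remb_eq {π ρ : Equiv.Perm (Fin n)}
    (hdb : db π = db ρ) (hdt : dt π = dt ρ) (hr : ∀ a, remb π a = remb ρ a) : π = ρ := by
  have key : ∀ k ≤ n, AgreeBelow π ρ k := by
    intro k
    induction k with
    | zero =>
      intro _
      refine ⟨fun u v hu => absurd hu (Nat.not_lt_zero _), ?_⟩
      ext v
      simp [mem_active]
    | succ k ih =>
      intro hk
      exact AgreeBelow.succ (a := ⟨k, hk⟩) (ih (by omega)) hdb hdt hr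
  have h := (key n le_rfl).1
  -- Equal relative order of all entries makes `ρ⁻¹π` an increasing bijection, hence the identity.
  have hmono : StrictMono fun i => ρ.symm (π i) := by
    intro i j hij
    have := (h (π i) (π j) (π i).2 (π j).2).1 (by simpa using hij)
    exact this
  have hid := (StrictMono.range_inj hmono strictMono_id).1 (by
    rw [Set.range_id]
    exact (ρ.symm.surjective.comp π.surjective).range_eq)
  ext i
  have := congrFun hid i
  simp only [id] at this
  rw [Equiv.symm_apply_eq] at this
  rw [this]

/-- The image determines `wexb` and `wext` as the positions and values of its weak excedances, and
`remb` by `remb_wex` and `remb_nwex`. Undoing the shifts by one gives `db` and `dt`. -/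
theorem psi_injective : Function.Injective (psi : Equiv.Perm (Fin n) → Equiv.Perm (Fin n)) := by
  intro π ρ h
  have hb : wexb π = wexb ρ := by
    ext a
    rw [mem_wexb_iff_le_psi, mem_wexb_iff_le_psi, h]
  have ht : wext π = wext ρ := by
    ext b
    obtain ⟨a, rfl⟩ := (psi π).surjective b
    rw [← mem_wexb_iff_psi_mem, hb, h, ← mem_wexb_iff_psi_mem]
  refine eq_of_db_dt_remb_eq ?_ ?_ ?_
  · have : ∀ π : Equiv.Perm (Fin n), ∀ a, a ∈ db π ↔ ∃ x ∈ wexb π, (x : ℕ) = a + 1 := by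
      intro π a
      constructor
      · intro ha
        exact ⟨⟨a + 1, lt_last_of_mem_db ha⟩, mem_wexb.2 (Or.inl ⟨a, ha, rfl⟩), rfl⟩
      · rintro ⟨x, hx, hxa⟩
        rcases mem_wexb.1 hx with ⟨b, hb, hxb⟩ | hx
        · rwa [show a = b from Fin.ext (by omega)]
        · omega
    ext a
    rw [this, this, hb]
  · have : ∀ π : Equiv.Perm (Fin n), ∀ a, a ∈ dt π ↔ ∃ x ∈ wext π, (x : ℕ) + 1 = a := by
      intro π a
      constructor
      · intro ha
        have := pos_of_mem_dt ha
        exact ⟨⟨a - 1, by omega⟩, mem_wext.2 (Or.inl ⟨a, ha, by simp only; omega⟩), by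
          simp only; omega⟩
      · rintro ⟨x, hx, hxa⟩
        rcases mem_wext.1 hx with ⟨b, hb, hxb⟩ | hx
        · rwa [show a = b from Fin.ext (by omega)]
        · omega
    ext a
    rw [this, this, ht]
  · intro a
    rcases le_or_gt a (psi π a) with ha | ha
    · rw [remb_wex π ha, remb_wex ρ (h ▸ ha), h]
    · rw [remb_nwex π ha, remb_nwex ρ (h ▸ ha), h]

/-- `Ψ` as a bijection. -/
noncomputable def psiEquiv : Equiv.Perm (Fin n) ≃ Equiv.Perm (Fin n) :=
  Equiv.ofBijective psi (Finite.injective_iff_bijective.1 psi_injective)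

theorem psiEquiv_image_avoiders :
    psiEquiv '' avoiders n pat31_2 = avoiders n pat3_2_1 := by
  ext σ
  constructor
  · rintro ⟨π, hπ, rfl⟩
    exact (psi_mem_avoiders_iff π).2 hπ
  · intro hσ
    obtain ⟨π, rfl⟩ := psiEquiv.surjective σ
    exact ⟨π, (psi_mem_avoiders_iff π).1 hσ, rfl⟩

end SteinWil

/-! ### Insertion of the largest element into a cycle through left-to-right maxima. -/

namespace CycleExt

variable {n : ℕ}

/-- The position `i` is a left-to-right maximum of `σ`. -/
def IsRecord (σ : Fin n → Fin n) (i : Fin n) : Prop := ∀ j, j < i → σ j < σ i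

/-- The image under `f` of the first element of `S` that is at least `p`, or the largest element
if there is none. -/
def landing (f : Fin n → Fin n) (S : Finset (Fin n)) (p : ℕ) : Fin (n + 1) :=
  if h : (S.filter fun i : Fin n => p ≤ i).Nonempty then (f (Finset.min' _ h)).castSucc
  else Fin.last n

/-- `g` arises from `f` by insertion of the largest element into the cycle through the elements
of `S`, in increasing order. -/
def IsExt (S : Finset (Fin n)) (f : Fin n → Fin n) (g : Fin (n + 1) → Fin (n + 1)) : Prop :=
  (∀ i ∉ S, g i.castSucc = (f i).castSucc) ∧ (∀ i ∈ S, g i.castSucc = landing f S (i + 1)) ∧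
    g (Fin.last n) = landing f S 0

theorem landing_eq_of_mem (f : Fin n → Fin n) {S : Finset (Fin n)} {p : ℕ} {j : Fin n}
    (hj : j ∈ S) (hp : p ≤ j) (h : ∀ k ∈ S, p ≤ k → j ≤ k) : landing f S p = (f j).castSucc := by
  have hne : (S.filter fun i : Fin n => p ≤ i).Nonempty := ⟨j, Finset.mem_filter.2 ⟨hj, hp⟩⟩
  have hmin := Finset.mem_filter.1 (Finset.min'_mem _ hne)
  rw [landing, dif_pos hne]
  congr 2
  exact le_antisymm (Finset.min'_le _ _ (Finset.mem_filter.2 ⟨hj, hp⟩)) (h _ hmin.1 hmin.2)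

theorem landing_eq_last (f : Fin n → Fin n) {S : Finset (Fin n)} {p : ℕ}
    (h : ∀ k ∈ S, (k : ℕ) < p) : landing f S p = Fin.last n := by
  rw [landing, dif_neg]
  rintro ⟨j, hj⟩
  rw [Finset.mem_filter] at hj
  have := h j hj.1
  omega

theorem landing_cases (f : Fin n → Fin n) (S : Finset (Fin n)) (p : ℕ) :
    (landing f S p = Fin.last n ∧ ∀ k ∈ S, (k : ℕ) < p) ∨
    ∃ j ∈ S, p ≤ j ∧ (∀ k ∈ S, p ≤ k → j ≤ k) ∧ landing f S p = (f j).castSucc := by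
  by_cases h : (S.filter fun i : Fin n => p ≤ i).Nonempty
  · have hmin := Finset.mem_filter.1 (Finset.min'_mem _ h)
    have hle : ∀ k ∈ S, p ≤ k → Finset.min' _ h ≤ k := fun k hk hp =>
      Finset.min'_le _ _ (Finset.mem_filter.2 ⟨hk, hp⟩)
    exact Or.inr ⟨_, hmin.1, hmin.2, hle, landing_eq_of_mem f hmin.1 hmin.2 hle⟩
  · have : ∀ k ∈ S, (k : ℕ) < p := fun k hk => by
      by_contra hp
      exact h ⟨k, Finset.mem_filter.2 ⟨hk, not_lt.1 hp⟩⟩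
    exact Or.inl ⟨landing_eq_last f this, this⟩

/-- The last element of `S` before `i`, or the largest element if there is none. -/
def prev (S : Finset (Fin n)) (i : Fin n) : Fin (n + 1) :=
  if h : (S.filter fun s => s < i).Nonempty then (Finset.max' _ h).castSucc else Fin.last n

theorem prev_cases (S : Finset (Fin n)) (i : Fin n) :
    (prev S i = Fin.last n ∧ ∀ s ∈ S, i ≤ s) ∨
    ∃ s ∈ S, s < i ∧ (∀ t ∈ S, t < i → t ≤ s) ∧ prev S i = s.castSucc := by
  by_cases h : (S.filter fun s => s < i).Nonempty
  · have hmax := Finset.mem_filter.1 (Finset.max'_mem _ h)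
    exact Or.inr ⟨_, hmax.1, hmax.2, fun t ht hti =>
      Finset.le_max' _ _ (Finset.mem_filter.2 ⟨ht, hti⟩), by rw [prev, dif_pos h]⟩
  · refine Or.inl ⟨by rw [prev, dif_neg h], fun s hs => ?_⟩
    by_contra hp
    exact h ⟨s, Finset.mem_filter.2 ⟨hs, not_le.1 hp⟩⟩

theorem prev_injOn {S : Finset (Fin n)} {i j : Fin n} (hi : i ∈ S) (hj : j ∈ S)
    (h : prev S i = prev S j) : i = j := by
  rcases prev_cases S i with ⟨h1, h2⟩ | ⟨s, h1, h2, h3, h4⟩ <;>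
    rcases prev_cases S j with ⟨k1, k2⟩ | ⟨t, k1, k2, k3, k4⟩
  · exact le_antisymm (h2 j hj) (k2 i hi)
  · rw [h1, k4] at h
    exact absurd h.symm (Fin.castSucc_lt_last t).ne
  · rw [h4, k1] at h
    exact absurd h (Fin.castSucc_lt_last s).ne
  · rw [h4, k4, Fin.castSucc_inj] at h
    subst h
    refine le_antisymm ?_ ?_
    · by_contra hlt
      exact absurd (h3 j hj (not_le.1 hlt)) (not_le.2 k2)
    · by_contra hlt
      exact absurd (k3 i hi (not_le.1 hlt)) (not_le.2 h2)

/-- The cycle read backwards: the value that `f` takes at `i` has moved to the preceding element of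
`S`, or to the new element if `i` comes first. Both existence and uniqueness of extensions rest on
this. -/
theorem IsExt.apply_prev {S : Finset (Fin n)} {f : Fin n → Fin n} {g : Fin (n + 1) → Fin (n + 1)}
    (h : IsExt S f g) {i : Fin n} (hi : i ∈ S) : g (prev S i) = (f i).castSucc := by
  rcases prev_cases S i with ⟨h1, h2⟩ | ⟨s, h1, h2, h3, h4⟩
  · rw [h1, h.2.2]
    exact landing_eq_of_mem f hi (Nat.zero_le _) fun k hk _ => h2 k hk
  · rw [h4, h.2.1 s h1]
    refine landing_eq_of_mem f hi h2 fun k hk hsk => ?_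
    by_contra hlt
    have := h3 k hk (not_le.1 hlt)
    rw [Fin.le_def] at this
    omega

theorem exists_isExt (S : Finset (Fin n)) (f : Equiv.Perm (Fin n)) :
    ∃ g : Equiv.Perm (Fin (n + 1)), IsExt S f g := by
  set g : Fin (n + 1) → Fin (n + 1) := fun x => Fin.lastCases (motive := fun _ => Fin (n + 1))
    (landing f S 0) (fun i => if i ∈ S then landing f S (i + 1) else (f i).castSucc) x with hg
  have hext : IsExt S f g := by
    refine ⟨fun i hi => ?_, fun i hi => ?_, ?_⟩
    · simp [hg, hi]
    · simp [hg, hi]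
    · simp [hg]
  have hsurj : Function.Surjective g := by
    intro y
    induction y using Fin.lastCases with
    | last =>
      rcases S.eq_empty_or_nonempty with hS | hS
      · exact ⟨_, hext.2.2.trans (landing_eq_last f (by simp [hS]))⟩
      · exact ⟨_, (hext.2.1 _ (S.max'_mem hS)).trans
          (landing_eq_last f fun k hk => Nat.lt_succ_of_le (S.le_max' k hk))⟩
    | cast v =>
      by_cases hv : f.symm v ∈ S
      · exact ⟨_, (hext.apply_prev hv).trans (by simp)⟩
      · exact ⟨_, (hext.1 _ hv).trans (by simp)⟩
  exact ⟨Equiv.ofBijective g (Finite.surjective_iff_bijective.1 hsurj), hext⟩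

theorem IsExt.unique_left {S : Finset (Fin n)} {f f' : Fin n → Fin n}
    {g : Fin (n + 1) → Fin (n + 1)} (h : IsExt S f g) (h' : IsExt S f' g) : f = f' := by
  funext i
  by_cases hi : i ∈ S
  · exact Fin.castSucc_injective n ((h.apply_prev hi).symm.trans (h'.apply_prev hi))
  · exact Fin.castSucc_injective n ((h.1 i hi).symm.trans (h'.1 i hi))

section records

variable {S : Finset (Fin n)} {f : Equiv.Perm (Fin n)} {g : Fin (n + 1) → Fin (n + 1)}

theorem castSucc_lt_landing (hS : ∀ i ∈ S, IsRecord f i) {i : Fin n} {p : ℕ}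
    (hi : ∀ k ∈ S, p ≤ k → i < k) : (f i).castSucc < landing f S p := by
  rcases landing_cases f S p with ⟨h1, h2⟩ | ⟨j, h1, h2, h3, h4⟩
  · rw [h1]; exact Fin.castSucc_lt_last _
  · rw [h4, Fin.castSucc_lt_castSucc_iff]
    exact hS j h1 i (hi j h1 h2)

theorem landing_le (hS : ∀ i ∈ S, IsRecord f i) {i : Fin n} {p : ℕ} (hi : i ∈ S) (hp : p ≤ i) :
    landing f S p ≤ (f i).castSucc := by
  rcases landing_cases f S p with ⟨h1, h2⟩ | ⟨j, h1, h2, h3, h4⟩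
  · exact absurd (h2 i hi) (not_lt.2 hp)
  · rw [h4, Fin.castSucc_le_castSucc_iff]
    rcases (h3 i hi hp).eq_or_lt with h | h
    · rw [h]
    · exact (hS i hi j h).le

theorem IsExt.castSucc_lt (h : IsExt S f g) (hS : ∀ i ∈ S, IsRecord f i) {i : Fin n} (hi : i ∈ S) :
    (f i).castSucc < g i.castSucc := by
  rw [h.2.1 i hi]
  exact castSucc_lt_landing hS fun k _ hk => hk

theorem IsExt.castSucc_le (h : IsExt S f g) (hS : ∀ i ∈ S, IsRecord f i) (i : Fin n) :
    (f i).castSucc ≤ g i.castSucc := by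
  by_cases hi : i ∈ S
  · exact (h.castSucc_lt hS hi).le
  · rw [h.1 i hi]

theorem IsExt.last_lt (h : IsExt S f g) (hS : ∀ i ∈ S, IsRecord f i) {i : Fin n} (hi : i ∈ S) :
    g (Fin.last n) < g i.castSucc := by
  rw [h.2.2]
  exact (landing_le hS hi (Nat.zero_le _)).trans_lt (h.castSucc_lt hS hi)

theorem IsExt.isRecord_of_mem (h : IsExt S f g) (hS : ∀ i ∈ S, IsRecord f i) {i : Fin n}
    (hi : i ∈ S) : IsRecord g i.castSucc := by
  intro x hx
  induction x using Fin.lastCases with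
  | last => exact h.last_lt hS hi
  | cast j =>
    rw [Fin.castSucc_lt_castSucc_iff] at hx
    refine lt_of_le_of_lt ?_ (h.castSucc_lt hS hi)
    by_cases hj : j ∈ S
    · rw [h.2.1 j hj]
      exact landing_le hS hi hx
    · rw [h.1 j hj, Fin.castSucc_le_castSucc_iff]
      exact (hS i hi j hx).le

/-- The last element `s` of `S` before `i` receives the value at the next element of `S` beyond `i`,
or the largest element. Either one exceeds `f i`, because elements of `S` are records. -/
theorem IsExt.exists_gt (h : IsExt S f g) (hS : ∀ i ∈ S, IsRecord f i) {i : Fin n}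
    (hi : i ∉ S) {t : Fin n} (ht : t ∈ S) (hti : t < i) :
    ∃ s ∈ S, s < i ∧ g i.castSucc < g s.castSucc := by
  rcases prev_cases S i with ⟨h1, h2⟩ | ⟨s, h1, h2, h3, h4⟩
  · exact absurd (h2 t ht) (not_le.2 hti)
  · refine ⟨s, h1, h2, ?_⟩
    rw [h.1 i hi, h.2.1 s h1]
    refine castSucc_lt_landing hS fun k hk hsk => ?_
    by_contra hlt
    rcases (not_lt.1 hlt).eq_or_lt with e | e
    · exact hi (e ▸ hk)
    · have := h3 k hk e
      rw [Fin.le_def] at this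
      omega

/-- The condition has the same form as in `PermTableau.unrestricted_addCol_iff`, which keeps records
and unrestricted rows in step. -/
theorem IsExt.isRecord_castSucc_iff (h : IsExt S f g) (hS : ∀ i ∈ S, IsRecord f i) (i : Fin n) :
    IsRecord g i.castSucc ↔ IsRecord f i ∧ (i ∈ S ∨ ∀ s ∈ S, i < s) := by
  by_cases hi : i ∈ S
  · simp [hi, hS i hi, h.isRecord_of_mem hS hi]
  · constructor
    · intro hr
      have hlt : ∀ s ∈ S, i < s := by
        intro s hs
        by_contra hle
        obtain ⟨t, _, ht, ht'⟩ := h.exists_gt hS hi hs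
          (lt_of_le_of_ne (not_lt.1 hle) fun e => hi (e ▸ hs))
        exact absurd (hr _ (Fin.castSucc_lt_castSucc_iff.2 ht)) (lt_asymm ht')
      refine ⟨fun j hj => ?_, Or.inr hlt⟩
      have hj' : j ∉ S := fun h' => absurd (hlt j h') (lt_asymm hj)
      have := hr _ (Fin.castSucc_lt_castSucc_iff.2 hj)
      rwa [h.1 i hi, h.1 j hj', Fin.castSucc_lt_castSucc_iff] at this
    · rintro ⟨hr, hlt⟩ x hx
      have hlt := hlt.resolve_left hi
      induction x using Fin.lastCases with
      | last => exact absurd hx (not_lt.2 (Fin.le_last _))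
      | cast j =>
        rw [Fin.castSucc_lt_castSucc_iff] at hx
        have hj' : j ∉ S := fun h' => absurd (hlt j h') (lt_asymm hx)
        rw [h.1 i hi, h.1 j hj', Fin.castSucc_lt_castSucc_iff]
        exact hr j hx

/-- This recovers `S` from `g`. A record outside `S` precedes all of `S`, so its value stays below
the one assigned to the new element. -/
theorem IsExt.mem_iff (h : IsExt S f g) (hS : ∀ i ∈ S, IsRecord f i) (i : Fin n) :
    i ∈ S ↔ IsRecord g i.castSucc ∧ g (Fin.last n) < g i.castSucc := by
  refine ⟨fun hi => ⟨h.isRecord_of_mem hS hi, h.last_lt hS hi⟩, ?_⟩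
  rintro ⟨h1, h2⟩
  rcases ((h.isRecord_castSucc_iff hS i).1 h1).2 with hi | hi
  · exact hi
  · by_contra hi'
    rw [h.1 i hi', h.2.2] at h2
    exact absurd h2 (lt_asymm (castSucc_lt_landing hS fun k hk _ => hi k hk))

theorem IsExt.isRecord_last_iff {g : Equiv.Perm (Fin (n + 1))} (h : IsExt S f g)
    (hS : ∀ i ∈ S, IsRecord f i) : IsRecord g (Fin.last n) ↔ S = ∅ := by
  constructor
  · intro hr
    rw [Finset.eq_empty_iff_forall_notMem]
    intro i hi
    exact absurd (hr _ (Fin.castSucc_lt_last i)) (lt_asymm (h.last_lt hS hi))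
  · intro he j hj
    have : g (Fin.last n) = Fin.last n := h.2.2.trans (landing_eq_last f (by simp [he]))
    rw [this]
    exact lt_of_le_of_ne (Fin.le_last _) fun e => hj.ne (g.injective (e.trans this.symm))

end records

theorem exists_isRecord_ge (g : Fin n → Fin n) (i : Fin n) :
    ∃ k ≤ i, IsRecord g k ∧ g i ≤ g k := by
  induction i using WellFoundedLT.induction with
  | ind i ih =>
    by_cases hr : IsRecord g i
    · exact ⟨i, le_rfl, hr, le_rfl⟩
    · simp only [IsRecord, not_forall, not_lt] at hr
      obtain ⟨j, hj, hji⟩ := hr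
      obtain ⟨k, hk, hr, hle⟩ := ih j hj
      exact ⟨k, hk.trans hj.le, hr, hji.trans hle⟩

/-- `S` is dictated by `IsExt.mem_iff` and `f` by `IsExt.apply_prev`; it remains to see that this
choice works. -/
theorem exists_isExt_left (g : Equiv.Perm (Fin (n + 1))) :
    ∃ (S : Finset (Fin n)) (f : Equiv.Perm (Fin n)), IsExt S f g ∧ ∀ i ∈ S, IsRecord f i := by
  classical
  set S : Finset (Fin n) := Finset.univ.filter fun i =>
    IsRecord g i.castSucc ∧ g (Fin.last n) < g i.castSucc with hS
  have mem : ∀ i, i ∈ S ↔ IsRecord g i.castSucc ∧ g (Fin.last n) < g i.castSucc := by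
    simp [hS]
  have hmono : ∀ i j, j ∈ S → i < j → g i.castSucc < g j.castSucc := fun i j hj hij =>
    ((mem j).1 hj).1 _ (Fin.castSucc_lt_castSucc_iff.2 hij)
  have hrec : ∀ i ∉ S, g (Fin.last n) < g i.castSucc →
      ∃ k ∈ S, k < i ∧ g i.castSucc < g k.castSucc := by
    intro i hi hlt
    obtain ⟨k, hk, hr, hle⟩ := exists_isRecord_ge g i.castSucc
    induction k using Fin.lastCases with
    | last => exact absurd hk (not_le.2 (Fin.castSucc_lt_last i))
    | cast k =>
      rw [Fin.castSucc_le_castSucc_iff] at hk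
      have hkS : k ∈ S := (mem k).2 ⟨hr, hlt.trans_le hle⟩
      have hki : k < i := lt_of_le_of_ne hk fun e => hi (e ▸ hkS)
      exact ⟨k, hkS, hki, lt_of_le_of_ne hle fun e => hki.ne'
        (Fin.castSucc_injective n (g.injective e))⟩
  -- The position of the largest value, if it is not the last one, lies in `S`. This is why the
  -- values `g (x i)` below are never the largest and `castPred` applies to them.
  have hlast : ∀ i : Fin n, g i.castSucc = Fin.last n → i ∈ S := by
    intro i hi
    have hlt : ∀ j, j ≠ i.castSucc → g j < g i.castSucc := fun j hj => by
      rw [hi]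
      exact lt_of_le_of_ne (Fin.le_last _) fun e => hj (g.injective (e.trans hi.symm))
    exact (mem i).2 ⟨fun j hj => hlt j hj.ne, hlt _ (Fin.castSucc_lt_last i).ne'⟩
  set x : Fin n → Fin (n + 1) := fun i => if i ∈ S then prev S i else i.castSucc with hx
  have hx1 : ∀ i ∈ S, x i = prev S i := fun i hi => by simp [hx, hi]
  have hx2 : ∀ i ∉ S, x i = i.castSucc := fun i hi => by simp [hx, hi]
  have hxlt : ∀ i ∈ S, g (x i) < g i.castSucc := by
    intro i hi
    rw [hx1 i hi]
    rcases prev_cases S i with ⟨h1, _⟩ | ⟨s, h1, h2, h3, h4⟩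
    · rw [h1]; exact ((mem i).1 hi).2
    · rw [h4]; exact hmono s i hi h2
  have hxne : ∀ i, g (x i) ≠ Fin.last n := by
    intro i
    by_cases hi : i ∈ S
    · exact ((hxlt i hi).trans_le (Fin.le_last _)).ne
    · rw [hx2 i hi]
      exact fun e => hi (hlast i e)
  have hxinj : Function.Injective x := by
    have mixed : ∀ i j, i ∈ S → j ∉ S → x i ≠ x j := by
      intro i j hi hj
      rw [hx1 i hi, hx2 j hj]
      rcases prev_cases S i with ⟨h1, _⟩ | ⟨s, h1, h2, h3, h4⟩
      · rw [h1]; exact (Fin.castSucc_lt_last j).ne'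
      · rw [h4]; exact fun e => hj (Fin.castSucc_injective n e ▸ h1)
    intro i j hij
    by_cases hi : i ∈ S <;> by_cases hj : j ∈ S
    · rw [hx1 i hi, hx1 j hj] at hij
      exact prev_injOn hi hj hij
    · exact absurd hij (mixed i j hi hj)
    · exact absurd hij.symm (mixed j i hj hi)
    · rw [hx2 i hi, hx2 j hj] at hij
      exact Fin.castSucc_injective n hij
  set f₀ : Fin n → Fin n := fun i => (g (x i)).castPred (hxne i) with hf₀
  have hf₀' : ∀ i, (f₀ i).castSucc = g (x i) := fun i => Fin.castSucc_castPred _ _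
  have hinj : Function.Injective f₀ := fun i j hij => by
    have := congrArg Fin.castSucc hij
    rw [hf₀', hf₀'] at this
    exact hxinj (g.injective this)
  refine ⟨S, Equiv.ofBijective f₀ (Finite.injective_iff_bijective.1 hinj), ?_, ?_⟩
  · show IsExt S f₀ g
    refine ⟨fun i hi => by rw [hf₀', hx2 i hi], fun i hi => ?_, ?_⟩
    · rcases landing_cases f₀ S (i + 1) with ⟨h1, h2⟩ | ⟨t, h1, h2, h3, h4⟩
      · rw [h1]
        obtain ⟨m, hm⟩ := g.surjective (Fin.last n)
        induction m using Fin.lastCases with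
        | last => exact absurd ((mem i).1 hi).2 (by rw [hm]; exact not_lt.2 (Fin.le_last _))
        | cast m =>
          rcases (Nat.lt_succ_iff.1 (h2 m (hlast m hm))).eq_or_lt with e | e
          · rw [← hm, Fin.ext e]
          · exact absurd (hmono m i hi e) (by rw [hm]; exact not_lt.2 (Fin.le_last _))
      · rw [h4, hf₀', hx1 t h1]
        rcases prev_cases S t with ⟨_, k2⟩ | ⟨s, k1, k2, k3, k4⟩
        · exact absurd (k2 i hi) (not_le.2 h2)
        · rw [k4]
          have e1 := k3 i hi h2
          rcases e1.eq_or_lt with e1 | e1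
          · rw [e1]
          · exact absurd (h3 s k1 e1) (not_le.2 k2)
    · rcases landing_cases f₀ S 0 with ⟨h1, h2⟩ | ⟨t, h1, h2, h3, h4⟩
      · rw [h1]
        obtain ⟨m, hm⟩ := g.surjective (Fin.last n)
        induction m using Fin.lastCases with
        | last => exact hm
        | cast m => exact absurd (h2 m (hlast m hm)) (Nat.not_lt_zero _)
      · rw [h4, hf₀', hx1 t h1]
        rcases prev_cases S t with ⟨k1, _⟩ | ⟨s, k1, k2, k3, k4⟩
        · rw [k1]
        · exact absurd (h3 s k1 (Nat.zero_le _)) (not_le.2 k2)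
  · intro j hj i hij
    show f₀ i < f₀ j
    rw [← Fin.castSucc_lt_castSucc_iff, hf₀', hf₀', hx1 j hj]
    by_cases hi : i ∈ S
    · rcases prev_cases S j with ⟨_, k2⟩ | ⟨s, k1, k2, k3, k4⟩
      · exact absurd (k2 i hi) (not_le.2 hij)
      · rw [k4]
        refine (hxlt i hi).trans_le ?_
        rcases (k3 i hi hij).eq_or_lt with e | e
        · rw [e]
        · exact (hmono i s k1 e).le
    · rw [hx2 i hi]
      have hprev : g (Fin.last n) ≤ g (prev S j) := by
        rcases prev_cases S j with ⟨k1, _⟩ | ⟨s, k1, k2, k3, k4⟩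
        · rw [k1]
        · rw [k4]; exact ((mem s).1 k1).2.le
      -- Either `i` lies below the value of the last position, which bounds all relevant values from
      -- below, or `hrec` provides an earlier element of `S` that dominates it.
      rcases lt_or_gt_of_ne fun e => (Fin.castSucc_lt_last i).ne (g.injective e) with h | h
      · exact h.trans_le hprev
      · obtain ⟨k, hk, hki, hgk⟩ := hrec i hi h
        rcases prev_cases S j with ⟨_, k2⟩ | ⟨s, k1, k2, k3, k4⟩
        · exact absurd (k2 k hk) (not_le.2 (hki.trans hij))
        · rw [k4]
          refine hgk.trans_le ?_
          rcases (k3 k hk (hki.trans hij)).eq_or_lt with e | e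
          · rw [e]
          · exact (hmono k s k1 e).le

/-- In a 3-2-1 of `f` the last two letters are not records, so they are unchanged in `g` while the
first can only grow. For the second claim, a violating `i` keeps a value above that of the new
element and is not a record of `g`, so it is the middle of a 3-2-1 ending at the new element. -/
theorem IsExt.avoids {S : Finset (Fin n)} {f : Equiv.Perm (Fin n)} {g : Equiv.Perm (Fin (n + 1))}
    (h : IsExt S f g) (hS : ∀ i ∈ S, IsRecord f i) (hg : g ∈ avoiders (n + 1) pat3_2_1) :
    f ∈ avoiders n pat3_2_1 ∧ ∀ s ∈ S, (∀ t ∈ S, s ≤ t) → ∀ i, f s < f i → i ∈ S := by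
  rw [mem_avoiders_pat3_2_1] at *
  constructor
  · intro i j k hij hjk h1 h2
    have hj : j ∉ S := fun hj => absurd (hS j hj i hij) (lt_asymm h2)
    have hk : k ∉ S := fun hk => absurd (hS k hk j hjk) (lt_asymm h1)
    refine hg i.castSucc j.castSucc k.castSucc hij hjk ?_ ?_
    · rwa [h.1 j hj, h.1 k hk, Fin.castSucc_lt_castSucc_iff]
    · refine lt_of_lt_of_le ?_ (h.castSucc_le hS i)
      rwa [h.1 j hj, Fin.castSucc_lt_castSucc_iff]
  · intro s hs hmin i hi
    by_contra hiS
    have hl : g (Fin.last n) < g i.castSucc := by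
      rw [h.1 i hiS, h.2.2, landing_eq_of_mem f hs (Nat.zero_le _) fun k hk _ => hmin k hk]
      exact Fin.castSucc_lt_castSucc_iff.2 hi
    have hr : ¬ IsRecord g i.castSucc := fun hr => hiS ((h.mem_iff hS i).2 ⟨hr, hl⟩)
    simp only [IsRecord, not_forall, not_lt] at hr
    obtain ⟨j, hj, hji⟩ := hr
    exact hg j i.castSucc (Fin.last n) hj (Fin.castSucc_lt_last i) hl
      (lt_of_le_of_ne hji fun e => hj.ne' (g.injective e))

end CycleExt

/-! ### Border labels, zigzag paths, and the removal of the last border step. -/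

namespace PermTableau

variable {n : ℕ} (T : PermTableau n)

theorem mem_shape_of_le {r r' c c' : ℕ} (hr : r' ≤ r) (hc : c' ≤ c) (h : (r, c) ∈ T.shape) :
    (r', c') ∈ T.shape := T.shape.up_left_mem hr hc h

theorem rowLen_le_cols (r : ℕ) : T.shape.rowLen r ≤ T.cols := by
  by_contra h
  rw [not_le, ← YoungDiagram.mem_iff_lt_rowLen] at h
  exact lt_irrefl _ (T.shape_sub _ _ h).2

theorem colLen_le_rows (c : ℕ) : T.shape.colLen c ≤ T.rows := by
  by_contra h
  rw [not_le, ← YoungDiagram.mem_iff_lt_colLen] at h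
  exact lt_irrefl _ (T.shape_sub _ _ h).1

theorem rowLabel_strictMono : StrictMono T.rowLabel := by
  intro r r' h
  have h1 := T.shape.rowLen_anti r r' h.le
  unfold rowLabel
  omega

theorem rowLabel_lt {r : ℕ} (h : r < T.rows) : T.rowLabel r < n := by
  have := T.rows_add_cols
  unfold rowLabel
  omega

theorem colLabel_lt_colLabel {c c' : ℕ} (h : c < c') (h' : c' < T.cols) :
    T.colLabel c' < T.colLabel c := by
  have h1 := T.shape.colLen_anti c c' h.le
  unfold colLabel
  omega

theorem colLabel_lt {c : ℕ} (h : c < T.cols) : T.colLabel c < n := by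
  have := T.rows_add_cols
  have := T.colLen_le_rows c
  unfold colLabel
  omega

/-- Whether the cell `(r, c)` belongs to the shape decides which of the two border steps comes
first. -/
theorem rowLabel_ne_colLabel (r : ℕ) {c : ℕ} (hc : c < T.cols) : T.rowLabel r ≠ T.colLabel c := by
  have h1 := T.rowLen_le_cols r
  unfold rowLabel colLabel
  by_cases h : (r, c) ∈ T.shape
  · have h2 := YoungDiagram.mem_iff_lt_rowLen.1 h
    have h3 := YoungDiagram.mem_iff_lt_colLen.1 h
    omega
  · have h2 := mt YoungDiagram.mem_iff_lt_rowLen.2 h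
    have h3 := mt YoungDiagram.mem_iff_lt_colLen.2 h
    omega

theorem exists_label (i : Fin n) :
    (∃ r < T.rows, (i : ℕ) = T.rowLabel r) ∨ ∃ c < T.cols, (i : ℕ) = T.colLabel c := by
  set L : Fin T.rows ⊕ Fin T.cols → Fin n :=
    Sum.elim (fun r => ⟨T.rowLabel r, T.rowLabel_lt r.2⟩)
      (fun c => ⟨T.colLabel c, T.colLabel_lt c.2⟩) with hL
  have hinj : Function.Injective L := by
    rintro (r | c) (r' | c') h <;> simp only [hL, Sum.elim_inl, Sum.elim_inr, Fin.mk.injEq] at h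
    · rw [Fin.ext (T.rowLabel_strictMono.injective h)]
    · exact absurd h (T.rowLabel_ne_colLabel _ c'.2)
    · exact absurd h.symm (T.rowLabel_ne_colLabel _ c.2)
    · rcases lt_trichotomy c c' with hc | hc | hc
      · exact absurd h (T.colLabel_lt_colLabel hc c'.2).ne'
      · rw [hc]
      · exact absurd h (T.colLabel_lt_colLabel hc c.2).ne
  have hbij : Function.Bijective L := by
    rw [Fintype.bijective_iff_injective_and_card]
    exact ⟨hinj, by simp [T.rows_add_cols]⟩
  obtain ⟨r | c, h⟩ := hbij.2 i
  · exact Or.inl ⟨r, r.2, by rw [← h]; rfl⟩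
  · exact Or.inr ⟨c, c.2, by rw [← h]; rfl⟩

variable {T}

theorem HasPerm.unique {σ ρ : Equiv.Perm (Fin n)} (h : T.HasPerm σ) (h' : T.HasPerm ρ) : σ = ρ := by
  ext i
  rcases T.exists_label i with ⟨r, hr, hi⟩ | ⟨c, hc, hi⟩
  · rw [h.1 i r hr hi, h'.1 i r hr hi]
  · rw [h.2 i c hc hi, h'.2 i c hc hi]

theorem exitLabel_east_of_notMem {r c : ℕ} (h : (r, c) ∉ T.shape) :
    T.exitLabel true r c = T.rowLabel r := by
  rw [exitLabel]; simp [h]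

theorem exitLabel_south_of_notMem {r c : ℕ} (h : (r, c) ∉ T.shape) :
    T.exitLabel false r c = T.colLabel c := by
  rw [exitLabel]; simp [h]

theorem exitLabel_east_of_one {r c : ℕ} (h : (r, c) ∈ T.ones) :
    T.exitLabel true r c = T.exitLabel false (r + 1) c := by
  rw [exitLabel]; simp [h, T.ones_sub r c h]

theorem exitLabel_south_of_one {r c : ℕ} (h : (r, c) ∈ T.ones) :
    T.exitLabel false r c = T.exitLabel true r (c + 1) := by
  rw [exitLabel]; simp [h, T.ones_sub r c h]

theorem exitLabel_east_of_zero {r c : ℕ} (h : (r, c) ∈ T.shape) (h' : (r, c) ∉ T.ones) :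
    T.exitLabel true r c = T.exitLabel true r (c + 1) := by
  rw [exitLabel]; simp [h, h']

theorem exitLabel_south_of_zero {r c : ℕ} (h : (r, c) ∈ T.shape) (h' : (r, c) ∉ T.ones) :
    T.exitLabel false r c = T.exitLabel false (r + 1) c := by
  rw [exitLabel]; simp [h, h']

/-- To prove something about all directed cells, one may suppose it for the cells to the
southeast. -/
theorem cell_induction (T : PermTableau n) {P : ℕ → ℕ → Prop}
    (out : ∀ r c, (r, c) ∉ T.shape → P r c)
    (step : ∀ r c, (r, c) ∈ T.shape → P r (c + 1) → P (r + 1) c → P r c) (r c : ℕ) : P r c := by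
  induction hk : T.rows + T.cols - (r + c) using Nat.strong_induction_on generalizing r c with
  | _ k ih =>
    by_cases h : (r, c) ∈ T.shape
    · have := T.shape_sub r c h
      exact step r c h (ih _ (by omega) _ _ rfl) (ih _ (by omega) _ _ rfl)
    · exact out r c h

/-- No zero of the row `r` has a one above it. -/
def Unrestricted (T : PermTableau n) (r : ℕ) : Prop :=
  ∀ c, (r, c) ∈ T.shape → ∀ r' < r, (r', c) ∈ T.ones → (r, c) ∈ T.ones

/-- Add an empty row at the bottom. -/
def addRow (T : PermTableau n) : PermTableau (n + 1) where
  rows := T.rows + 1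
  cols := T.cols
  rows_add_cols := by have := T.rows_add_cols; omega
  shape := T.shape
  shape_sub r c h := by have := T.shape_sub r c h; omega
  ones := T.ones
  ones_sub := T.ones_sub
  column := T.column
  hinge := T.hinge

/-- The shape of `T` with a column of full height added on the left. -/
def addColShape (T : PermTableau n) : YoungDiagram where
  cells := (Finset.range T.rows).image (fun r => (r, 0)) ∪
    T.shape.cells.image fun x => (x.1, x.2 + 1)
  isLowerSet := by
    rintro ⟨r, c⟩ ⟨r', c'⟩ h h'
    have hr : r' ≤ r := h.1
    have hc : c' ≤ c := h.2
    simp only [Finset.coe_union, Finset.coe_image, Set.mem_union, Set.mem_image, Finset.mem_coe,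
      Finset.mem_range, Prod.mk.injEq, Prod.exists, YoungDiagram.mem_cells] at h' ⊢
    rcases h' with ⟨a, ha, rfl, rfl⟩ | ⟨a, b, hab, rfl, rfl⟩
    · exact Or.inl ⟨r', by omega, rfl, by omega⟩
    · rcases c' with _ | c'
      · exact Or.inl ⟨r', hr.trans_lt (T.shape_sub _ _ hab).1, rfl, rfl⟩
      · exact Or.inr ⟨r', c', T.mem_shape_of_le hr (by omega) hab, rfl, rfl⟩

theorem mem_addColShape_zero (T : PermTableau n) {r : ℕ} :
    (r, 0) ∈ T.addColShape ↔ r < T.rows := by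
  rw [← YoungDiagram.mem_cells]
  simp [addColShape]

theorem mem_addColShape_succ (T : PermTableau n) {r c : ℕ} :
    (r, c + 1) ∈ T.addColShape ↔ (r, c) ∈ T.shape := by
  rw [← YoungDiagram.mem_cells]
  simp [addColShape]

/-- Add a column of full height on the left, with ones in the rows of `S`. -/
def addCol (T : PermTableau n) (S : Finset ℕ) (hne : S.Nonempty)
    (hS : ∀ r ∈ S, r < T.rows ∧ T.Unrestricted r) : PermTableau (n + 1) where
  rows := T.rows
  cols := T.cols + 1
  rows_add_cols := by have := T.rows_add_cols; omega
  shape := T.addColShape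
  shape_sub r c h := by
    rcases c with _ | c
    · rw [mem_addColShape_zero] at h
      omega
    · rw [mem_addColShape_succ] at h
      have := T.shape_sub r c h
      omega
  ones := S.image (fun r => (r, 0)) ∪ T.ones.image fun x => (x.1, x.2 + 1)
  ones_sub r c h := by
    rcases c with _ | c
    · rw [mem_addColShape_zero]
      simp at h
      exact (hS r h).1
    · rw [mem_addColShape_succ]
      simp at h
      exact T.ones_sub r c h
  column c hc := by
    rcases c with _ | c
    · obtain ⟨r, hr⟩ := hne
      exact ⟨r, by simp [hr]⟩
    · obtain ⟨r, hr⟩ := T.column c (by omega)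
      exact ⟨r, by simp [hr]⟩
  hinge r r' c c' hr hc h h1 h2 := by
    rcases c with _ | c
    · omega
    · rw [mem_addColShape_succ] at h
      rcases c' with _ | c'
      · simp at h1 h2 ⊢
        exact (hS r h2).2 c h r' hr h1
      · simp at h1 h2 ⊢
        exact T.hinge r r' c c' hr (by omega) h h1 h2

section addCol

variable {S : Finset ℕ} {hne : S.Nonempty} {hS : ∀ r ∈ S, r < T.rows ∧ T.Unrestricted r}

theorem mem_addCol_shape_zero {r : ℕ} : (r, 0) ∈ (T.addCol S hne hS).shape ↔ r < T.rows :=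
  T.mem_addColShape_zero

theorem mem_addCol_shape_succ {r c : ℕ} :
    (r, c + 1) ∈ (T.addCol S hne hS).shape ↔ (r, c) ∈ T.shape :=
  T.mem_addColShape_succ

theorem mem_addCol_ones_zero {r : ℕ} : (r, 0) ∈ (T.addCol S hne hS).ones ↔ r ∈ S := by
  simp [addCol]

theorem mem_addCol_ones_succ {r c : ℕ} :
    (r, c + 1) ∈ (T.addCol S hne hS).ones ↔ (r, c) ∈ T.ones := by
  simp [addCol]

theorem rowLen_addCol {r : ℕ} (hr : r < T.rows) :
    (T.addCol S hne hS).shape.rowLen r = T.shape.rowLen r + 1 := by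
  refine eq_of_forall_lt_iff fun c => ?_
  rw [← YoungDiagram.mem_iff_lt_rowLen]
  rcases c with _ | c
  · simp [mem_addCol_shape_zero, hr]
  · rw [mem_addCol_shape_succ, YoungDiagram.mem_iff_lt_rowLen, Nat.succ_lt_succ_iff]

theorem colLen_addCol_zero : (T.addCol S hne hS).shape.colLen 0 = T.rows := by
  refine eq_of_forall_lt_iff fun r => ?_
  rw [← YoungDiagram.mem_iff_lt_colLen, mem_addCol_shape_zero]

theorem colLen_addCol_succ (c : ℕ) :
    (T.addCol S hne hS).shape.colLen (c + 1) = T.shape.colLen c := by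
  refine eq_of_forall_lt_iff fun r => ?_
  rw [← YoungDiagram.mem_iff_lt_colLen, mem_addCol_shape_succ, YoungDiagram.mem_iff_lt_colLen]

theorem rowLabel_addCol {r : ℕ} (hr : r < T.rows) :
    (T.addCol S hne hS).rowLabel r = T.rowLabel r := by
  have h : (T.addCol S hne hS).cols = T.cols + 1 := rfl
  rw [rowLabel, rowLabel, rowLen_addCol hr, h]
  omega

theorem colLabel_addCol_zero : (T.addCol S hne hS).colLabel 0 = n := by
  have h : (T.addCol S hne hS).cols = T.cols + 1 := rfl
  have := T.rows_add_cols
  rw [colLabel, colLen_addCol_zero, h]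
  omega

theorem colLabel_addCol_succ (c : ℕ) :
    (T.addCol S hne hS).colLabel (c + 1) = T.colLabel c := by
  have h : (T.addCol S hne hS).cols = T.cols + 1 := rfl
  rw [colLabel, colLabel, colLen_addCol_succ, h]
  omega

/-- Away from the new column the paths are those of `T` shifted by one. The bound on `r` matters for
eastward paths: below the rectangle the new column does not lengthen the row, so the formal row
labels differ. -/
theorem exitLabel_addCol_succ (r c : ℕ) :
    (r < T.rows → (T.addCol S hne hS).exitLabel true r (c + 1) = T.exitLabel true r c) ∧
      (T.addCol S hne hS).exitLabel false r (c + 1) = T.exitLabel false r c := by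
  refine T.cell_induction (P := fun r c => (r < T.rows →
    (T.addCol S hne hS).exitLabel true r (c + 1) = T.exitLabel true r c) ∧
      (T.addCol S hne hS).exitLabel false r (c + 1) = T.exitLabel false r c) ?_ ?_ r c
  · intro r c h
    have h' : (r, c + 1) ∉ (T.addCol S hne hS).shape := by rwa [mem_addCol_shape_succ]
    rw [exitLabel_east_of_notMem h, exitLabel_east_of_notMem h', exitLabel_south_of_notMem h,
      exitLabel_south_of_notMem h', colLabel_addCol_succ]
    exact ⟨rowLabel_addCol, rfl⟩
  · intro r c h ih1 ih2
    have h' : (r, c + 1) ∈ (T.addCol S hne hS).shape := by rwa [mem_addCol_shape_succ]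
    have hr := (T.shape_sub r c h).1
    by_cases ho : (r, c) ∈ T.ones
    · have ho' : (r, c + 1) ∈ (T.addCol S hne hS).ones := by rwa [mem_addCol_ones_succ]
      rw [exitLabel_east_of_one ho, exitLabel_east_of_one ho', exitLabel_south_of_one ho,
        exitLabel_south_of_one ho']
      exact ⟨fun _ => ih2.2, ih1.1 hr⟩
    · have ho' : (r, c + 1) ∉ (T.addCol S hne hS).ones := by rwa [mem_addCol_ones_succ]
      rw [exitLabel_east_of_zero h ho, exitLabel_east_of_zero h' ho', exitLabel_south_of_zero h ho,
        exitLabel_south_of_zero h' ho']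
      exact ⟨ih1.1, ih2.2⟩

theorem unrestricted_addCol_iff {r : ℕ} (hr : r < T.rows) :
    (T.addCol S hne hS).Unrestricted r ↔ T.Unrestricted r ∧ (r ∈ S ∨ ∀ s ∈ S, r < s) := by
  constructor
  · intro h
    constructor
    · intro c hc r' hr' ho
      exact mem_addCol_ones_succ.1
        (h (c + 1) (mem_addCol_shape_succ.2 hc) r' hr' (mem_addCol_ones_succ.2 ho))
    · rw [or_iff_not_imp_left]
      intro hrS s hs
      by_contra hlt
      refine hrS (mem_addCol_ones_zero.1 (h 0 (mem_addCol_shape_zero.2 hr) s ?_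
        (mem_addCol_ones_zero.2 hs)))
      exact lt_of_le_of_ne (not_lt.1 hlt) fun e => hrS (e ▸ hs)
  · rintro ⟨h1, h2⟩ c hc r' hr' ho
    rcases c with _ | c
    · rw [mem_addCol_ones_zero] at *
      exact h2.resolve_right fun h => absurd (h r' ho) (lt_asymm hr')
    · rw [mem_addCol_ones_succ, mem_addCol_shape_succ] at *
      exact h1 c hc r' hr' ho

end addCol

theorem exitLabel_addRow (e : Bool) (r c : ℕ) : T.addRow.exitLabel e r c = T.exitLabel e r c := by
  refine T.cell_induction (P := fun r c => ∀ e, T.addRow.exitLabel e r c = T.exitLabel e r c)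
    ?_ ?_ r c e
  · intro r c h e
    have h' : (r, c) ∉ T.addRow.shape := h
    cases e
    · rw [exitLabel_south_of_notMem h, exitLabel_south_of_notMem h']; rfl
    · rw [exitLabel_east_of_notMem h, exitLabel_east_of_notMem h']; rfl
  · intro r c h ih1 ih2 e
    have h' : (r, c) ∈ T.addRow.shape := h
    by_cases ho : (r, c) ∈ T.ones
    · have ho' : (r, c) ∈ T.addRow.ones := ho
      cases e
      · rw [exitLabel_south_of_one ho, exitLabel_south_of_one ho', ih1]
      · rw [exitLabel_east_of_one ho, exitLabel_east_of_one ho', ih2]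
    · have ho' : (r, c) ∉ T.addRow.ones := ho
      cases e
      · rw [exitLabel_south_of_zero h ho, exitLabel_south_of_zero h' ho', ih2]
      · rw [exitLabel_east_of_zero h ho, exitLabel_east_of_zero h' ho', ih1]

/-- The last border step is horizontal iff there is a leftmost column and it has full height;
otherwise the bottom row is empty. -/
theorem eq_addRow_or_eq_addCol (T : PermTableau (n + 1)) :
    (∃ T' : PermTableau n, T = T'.addRow) ∨
      ∃ (T' : PermTableau n) (S : Finset ℕ) (hne : S.Nonempty)
        (hS : ∀ r ∈ S, r < T'.rows ∧ T'.Unrestricted r), T = T'.addCol S hne hS := by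
  have hsum := T.rows_add_cols
  by_cases hfull : 0 < T.cols ∧ ∀ r < T.rows, (r, 0) ∈ T.shape
  · right
    obtain ⟨hc, hfull⟩ := hfull
    have hinj : ∀ s : Set (ℕ × ℕ), s.InjOn fun x : ℕ × ℕ => (x.1, x.2 + 1) := by
      rintro s ⟨a, b⟩ _ ⟨a', b'⟩ _ h
      simpa using h
    let sh : YoungDiagram := ⟨T.shape.cells.preimage _ (hinj _), by
      rintro ⟨r, c⟩ ⟨r', c'⟩ h h'
      have hr : r' ≤ r := h.1
      have hc : c' ≤ c := h.2
      simp only [Finset.coe_preimage, Set.mem_preimage, Finset.mem_coe,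
        YoungDiagram.mem_cells] at h' ⊢
      exact T.mem_shape_of_le hr (by omega) h'⟩
    have msh : ∀ r c, (r, c) ∈ sh ↔ (r, c + 1) ∈ T.shape := fun r c => by
      rw [← YoungDiagram.mem_cells, ← YoungDiagram.mem_cells]
      simp [sh]
    have mpre : ∀ r c, (r, c) ∈ T.ones.preimage _ (hinj _) ↔ (r, c + 1) ∈ T.ones :=
      fun r c => Finset.mem_preimage
    let T' : PermTableau n :=
      { rows := T.rows
        cols := T.cols - 1
        rows_add_cols := by omega
        shape := sh
        shape_sub := fun r c h => by
          have := T.shape_sub _ _ ((msh r c).1 h)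
          omega
        ones := T.ones.preimage _ (hinj _)
        ones_sub := fun r c h => by
          rw [msh]
          exact T.ones_sub _ _ ((mpre r c).1 h)
        column := fun c hc => by
          obtain ⟨r, hr⟩ := T.column (c + 1) (by omega)
          exact ⟨r, (mpre r c).2 hr⟩
        hinge := fun r r' c c' hr hc h h1 h2 => by
          rw [msh] at h
          exact (mpre r c).2 (T.hinge r r' (c + 1) (c' + 1) hr (by omega) h
            ((mpre r' c).1 h1) ((mpre r c').1 h2)) }
    have mones : ∀ r c, (r, c) ∈ T'.ones ↔ (r, c + 1) ∈ T.ones := mpre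
    let S : Finset ℕ := (Finset.range T.rows).filter fun r => (r, 0) ∈ T.ones
    have mS : ∀ r, r ∈ S ↔ (r, 0) ∈ T.ones := fun r => by
      simp only [S, Finset.mem_filter, Finset.mem_range, and_iff_right_iff_imp]
      exact fun h => (T.shape_sub _ _ (T.ones_sub _ _ h)).1
    have hne : S.Nonempty := by
      obtain ⟨r, hr⟩ := T.column 0 hc
      exact ⟨r, (mS r).2 hr⟩
    have hS : ∀ r ∈ S, r < T'.rows ∧ T'.Unrestricted r := by
      intro r hr
      rw [mS] at hr
      refine ⟨(T.shape_sub _ _ (T.ones_sub _ _ hr)).1, fun c hc r' hr' ho => ?_⟩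
      rw [mones] at *
      -- The hinge condition with the leftmost column says exactly that a row with a one there is
      -- unrestricted in the rest of the tableau.
      exact T.hinge r r' (c + 1) 0 hr' (Nat.succ_pos c) ((msh r c).1 hc) ho hr
    refine ⟨T', S, hne, hS, ?_⟩
    ext x
    · rfl
    · show T.cols = T.cols - 1 + 1
      omega
    · obtain ⟨r, c⟩ := x
      rcases c with _ | c
      · rw [YoungDiagram.mem_cells, YoungDiagram.mem_cells, mem_addCol_shape_zero]
        exact ⟨fun h => (T.shape_sub _ _ h).1, hfull r⟩
      · rw [YoungDiagram.mem_cells, YoungDiagram.mem_cells, mem_addCol_shape_succ]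
        exact (msh r c).symm
    · obtain ⟨r, c⟩ := x
      rcases c with _ | c
      · rw [mem_addCol_ones_zero, mS]
      · rw [mem_addCol_ones_succ, mones]
  · left
    have hlast : (T.rows - 1, 0) ∉ T.shape := by
      intro h
      refine hfull ⟨(T.shape_sub _ _ h).2, fun r hr => T.mem_shape_of_le (by omega) le_rfl h⟩
    have hpos : 0 < T.rows := by
      by_contra h0
      exact hfull ⟨by omega, fun r hr => by omega⟩
    exact ⟨{ T with
      rows := T.rows - 1
      rows_add_cols := by omega
      shape_sub := fun r c h => by
        have h1 := T.shape_sub r c h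
        refine ⟨?_, h1.2⟩
        by_contra h2
        exact hlast (T.mem_shape_of_le (by omega) (Nat.zero_le _) h) }, by
      ext x
      · show T.rows = T.rows - 1 + 1
        omega
      · rfl
      · rfl
      · rfl⟩

end PermTableau

/-! ### Bijectivity of Φ by parallel recursions on tableaux and permutations. -/

namespace PermTableau

open CycleExt

variable {n : ℕ} {T : PermTableau n}

/-- The labels of the rows in `S`. -/
def rowLabels (T : PermTableau n) (S : Finset ℕ) : Finset (Fin n) :=
  Finset.univ.filter fun i => ∃ r ∈ S, (i : ℕ) = T.rowLabel r

theorem mem_rowLabels {S : Finset ℕ} {i : Fin n} :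
    i ∈ T.rowLabels S ↔ ∃ r ∈ S, (i : ℕ) = T.rowLabel r := by simp [rowLabels]

theorem mem_rowLabels_of_eq {S : Finset ℕ} {i : Fin n} {r : ℕ} (h : (i : ℕ) = T.rowLabel r) :
    i ∈ T.rowLabels S ↔ r ∈ S := by
  rw [mem_rowLabels]
  refine ⟨fun ⟨r', hr', h'⟩ => ?_, fun hr => ⟨r, hr, h⟩⟩
  rwa [T.rowLabel_strictMono.injective (h.symm.trans h')]

/-- The records of `σ` are the labels of the unrestricted rows of `T`. -/
def HasRecords (T : PermTableau n) (σ : Equiv.Perm (Fin n)) : Prop :=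
  ∀ i : Fin n, IsRecord σ i ↔ ∃ r < T.rows, (i : ℕ) = T.rowLabel r ∧ T.Unrestricted r

theorem HasRecords.iff_of_eq {σ : Equiv.Perm (Fin n)} (h : T.HasRecords σ) {i : Fin n} {r : ℕ}
    (hr : r < T.rows) (hi : (i : ℕ) = T.rowLabel r) : IsRecord σ i ↔ T.Unrestricted r := by
  rw [h i]
  refine ⟨fun ⟨r', _, h', hu⟩ => ?_, fun hu => ⟨r, hr, hi, hu⟩⟩
  rwa [T.rowLabel_strictMono.injective (hi.symm.trans h')]

theorem HasRecords.isRecord {σ : Equiv.Perm (Fin n)} (h : T.HasRecords σ) {S : Finset ℕ}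
    (hS : ∀ r ∈ S, r < T.rows ∧ T.Unrestricted r) : ∀ i ∈ T.rowLabels S, IsRecord σ i := by
  intro i hi
  obtain ⟨r, hr, hi⟩ := mem_rowLabels.1 hi
  exact (h i).2 ⟨r, (hS r hr).1, hi, (hS r hr).2⟩

theorem eq_castSucc {x : Fin (n + 1)} {m : ℕ} (hx : (x : ℕ) = m) (h : m < n) :
    x = (⟨m, h⟩ : Fin n).castSucc := Fin.ext hx

theorem rowLabel_addRow_last : T.addRow.rowLabel T.rows = n := by
  have h1 : (T.rows, 0) ∉ T.shape := fun h => lt_irrefl _ (T.shape_sub _ _ h).1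
  have h2 := mt YoungDiagram.mem_iff_lt_rowLen.2 h1
  have := T.rows_add_cols
  show T.rows + (T.cols - T.shape.rowLen T.rows) = n
  omega

theorem HasPerm.addRow {f : Equiv.Perm (Fin n)} {g : Equiv.Perm (Fin (n + 1))} (hf : T.HasPerm f)
    (hg : IsExt ∅ f g) : T.addRow.HasPerm g := by
  constructor
  · intro x r hr hx
    rw [exitLabel_addRow]
    rcases (Nat.lt_succ_iff.1 hr).eq_or_lt with rfl | hr
    · rw [rowLabel_addRow_last] at hx
      have hx' : x = Fin.last n := Fin.ext hx
      have h1 : (T.rows, 0) ∉ T.shape := fun h => lt_irrefl _ (T.shape_sub _ _ h).1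
      rw [hx', hg.2.2, landing_eq_last f (by simp), exitLabel_east_of_notMem h1]
      exact rowLabel_addRow_last.symm
    · rw [eq_castSucc hx (T.rowLabel_lt hr), hg.1 _ (Finset.notMem_empty _)]
      exact hf.1 _ r hr rfl
  · intro x c hc hx
    rw [exitLabel_addRow, eq_castSucc hx (T.colLabel_lt hc), hg.1 _ (Finset.notMem_empty _)]
    exact hf.2 _ c hc rfl

theorem HasRecords.addRow {f : Equiv.Perm (Fin n)} {g : Equiv.Perm (Fin (n + 1))}
    (hf : T.HasRecords f) (hg : IsExt ∅ f g) : T.addRow.HasRecords g := by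
  intro x
  induction x using Fin.lastCases with
  | last =>
    rw [hg.isRecord_last_iff (by simp)]
    refine iff_of_true rfl ⟨T.rows, Nat.lt_succ_self _, rowLabel_addRow_last.symm, ?_⟩
    intro c hc
    exact absurd (T.shape_sub _ _ hc).1 (lt_irrefl _)
  | cast i =>
    rw [hg.isRecord_castSucc_iff (by simp), hf i]
    constructor
    · rintro ⟨⟨r, hr, hi, hu⟩, -⟩
      exact ⟨r, Nat.lt_succ_of_lt hr, hi, hu⟩
    · rintro ⟨r, hr, hi, hu⟩
      refine ⟨?_, Or.inr (by simp)⟩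
      rcases (Nat.lt_succ_iff.1 hr).eq_or_lt with rfl | hr
      · rw [rowLabel_addRow_last] at hi
        exact absurd hi i.2.ne
      · exact ⟨r, hr, hi, hu⟩

section addCol

variable {S : Finset ℕ} {hne : S.Nonempty} {hS : ∀ r ∈ S, r < T.rows ∧ T.Unrestricted r}
  {f : Equiv.Perm (Fin n)} {g : Equiv.Perm (Fin (n + 1))}

/-- A path going south in the new column falls to the first row of `S` from `r` on, turns east there
and continues as the path of that row in `T`. The parameter `p` is the threshold on labels that
corresponds to `r`; it is used as 0 for the new column and as one more than the label of a row of
`S` for the path of that row. -/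
theorem HasPerm.exitLabel_addCol_zero (hf : T.HasPerm f) (r p : ℕ) (hr : r ≤ T.rows)
    (hp : ∀ s ∈ S, r ≤ s ↔ p ≤ T.rowLabel s) :
    (T.addCol S hne hS).exitLabel false r 0 = landing f (T.rowLabels S) p := by
  induction hr using Nat.decreasingInduction with
  | self =>
    rw [exitLabel_south_of_notMem (by rw [mem_addCol_shape_zero]; exact lt_irrefl _),
      colLabel_addCol_zero, landing_eq_last, Fin.val_last]
    intro i hi
    obtain ⟨s, hs, hi⟩ := mem_rowLabels.1 hi
    rw [hi]
    by_contra hlt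
    exact absurd ((hp s hs).2 (not_lt.1 hlt)) (not_le.2 (hS s hs).1)
  | of_succ r hr ih =>
    have hsh : (r, 0) ∈ (T.addCol S hne hS).shape := mem_addCol_shape_zero.2 hr
    by_cases hrS : r ∈ S
    · rw [exitLabel_south_of_one (mem_addCol_ones_zero.2 hrS),
        (exitLabel_addCol_succ r 0).1 hr, landing_eq_of_mem f (j := ⟨_, T.rowLabel_lt hr⟩)]
      · exact (hf.1 _ r hr rfl).symm
      · exact (mem_rowLabels_of_eq rfl).2 hrS
      · exact (hp r hrS).1 le_rfl
      · intro i hi hpi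
        obtain ⟨s, hs, hi⟩ := mem_rowLabels.1 hi
        rw [hi] at hpi
        rw [Fin.le_def, hi]
        exact T.rowLabel_strictMono.monotone ((hp s hs).2 hpi)
    · rw [exitLabel_south_of_zero hsh (by rwa [mem_addCol_ones_zero])]
      refine ih fun s hs => ?_
      rw [← hp s hs]
      have : r ≠ s := fun e => hrS (e ▸ hs)
      omega

theorem HasPerm.addCol (hf : T.HasPerm f) (hg : IsExt (T.rowLabels S) f g) :
    (T.addCol S hne hS).HasPerm g := by
  constructor
  · intro x r hr hx
    have hr : r < T.rows := hr
    rw [rowLabel_addCol hr] at hx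
    have hlt := T.rowLabel_lt hr
    rw [eq_castSucc hx hlt]
    by_cases hrS : r ∈ S
    · rw [exitLabel_east_of_one (mem_addCol_ones_zero.2 hrS),
        hg.2.1 _ ((mem_rowLabels_of_eq rfl).2 hrS)]
      refine (hf.exitLabel_addCol_zero _ _ hr fun s _ => ?_).symm
      exact T.rowLabel_strictMono.lt_iff_lt.symm
    · rw [exitLabel_east_of_zero (mem_addCol_shape_zero.2 hr) (by rwa [mem_addCol_ones_zero]),
        hg.1 _ (fun h => hrS ((mem_rowLabels_of_eq rfl).1 h)), (exitLabel_addCol_succ r 0).1 hr]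
      exact hf.1 _ r hr rfl
  · intro x c hc hx
    rcases c with _ | c
    · rw [colLabel_addCol_zero] at hx
      rw [show x = Fin.last n from Fin.ext hx, hg.2.2]
      exact (hf.exitLabel_addCol_zero 0 0 (Nat.zero_le _) (by simp)).symm
    · have hc : c < T.cols := Nat.lt_of_succ_lt_succ hc
      rw [colLabel_addCol_succ] at hx
      rw [eq_castSucc hx (T.colLabel_lt hc), hg.1, (exitLabel_addCol_succ 0 c).2]
      · exact hf.2 _ c hc rfl
      · intro h
        obtain ⟨r, _, hr⟩ := mem_rowLabels.1 h
        exact T.rowLabel_ne_colLabel r hc hr.symm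

theorem HasRecords.addCol (hf : T.HasRecords f) (hg : IsExt (T.rowLabels S) f g) :
    (T.addCol S hne hS).HasRecords g := by
  have hrec := hf.isRecord hS
  have hlab : ∀ {r}, r < T.rows → ((T.addCol S hne hS).rowLabel r) = T.rowLabel r :=
    rowLabel_addCol
  intro x
  induction x using Fin.lastCases with
  | last =>
    rw [hg.isRecord_last_iff hrec]
    refine iff_of_false ?_ ?_
    · obtain ⟨r, hr⟩ := hne
      refine Finset.ne_empty_of_mem (a := ⟨_, T.rowLabel_lt (hS r hr).1⟩) ?_
      exact (mem_rowLabels_of_eq rfl).2 hr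
    · rintro ⟨r, hr, hi, -⟩
      have hr : r < T.rows := hr
      rw [hlab hr, Fin.val_last] at hi
      exact (T.rowLabel_lt hr).ne' hi
  | cast i =>
    rw [hg.isRecord_castSucc_iff hrec]
    have key : ∀ r < T.rows, (i : ℕ) = T.rowLabel r →
        ((i ∈ T.rowLabels S ∨ ∀ s ∈ T.rowLabels S, i < s) ↔ (r ∈ S ∨ ∀ s ∈ S, r < s)) := by
      intro r hr hi
      rw [mem_rowLabels_of_eq hi]
      refine or_congr_right ⟨fun h s hs => ?_, fun h s hs => ?_⟩
      · have := h ⟨_, T.rowLabel_lt (hS s hs).1⟩ ((mem_rowLabels_of_eq rfl).2 hs)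
        rw [Fin.lt_def, hi] at this
        exact T.rowLabel_strictMono.lt_iff_lt.1 this
      · obtain ⟨t, ht, hs⟩ := mem_rowLabels.1 hs
        rw [Fin.lt_def, hi, hs]
        exact T.rowLabel_strictMono (h t ht)
    constructor
    · rintro ⟨h1, h2⟩
      obtain ⟨r, hr, hi, hu⟩ := (hf i).1 h1
      refine ⟨r, hr, ?_, (unrestricted_addCol_iff hr).2 ⟨hu, (key r hr hi).1 h2⟩⟩
      rw [hlab hr]
      exact hi
    · rintro ⟨r, hr, hi, hu⟩
      have hr : r < T.rows := hr
      rw [hlab hr] at hi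
      have hi : (i : ℕ) = T.rowLabel r := hi
      obtain ⟨hu, h2⟩ := (unrestricted_addCol_iff hr).1 hu
      exact ⟨(hf i).2 ⟨r, hr, hi, hu⟩, (key r hr hi).2 h2⟩

end addCol

/-- The permutation and its records are built together: the description of the records of an
extension needs the labels of `S` to be records of the smaller permutation. -/
theorem exists_hasPerm_hasRecords :
    ∀ {n : ℕ} (T : PermTableau n), ∃ σ, T.HasPerm σ ∧ T.HasRecords σ
  | 0, _ => ⟨1, ⟨fun i => i.elim0, fun i => i.elim0⟩, fun i => i.elim0⟩
  | n + 1, T => by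
    rcases T.eq_addRow_or_eq_addCol with ⟨T', rfl⟩ | ⟨T', S, hne, hS, rfl⟩
    · obtain ⟨f, hf, hr⟩ := T'.exists_hasPerm_hasRecords
      obtain ⟨g, hg⟩ := exists_isExt ∅ f
      exact ⟨g, hf.addRow hg, hr.addRow hg⟩
    · obtain ⟨f, hf, hr⟩ := T'.exists_hasPerm_hasRecords
      obtain ⟨g, hg⟩ := exists_isExt (T'.rowLabels S) f
      exact ⟨g, hf.addCol hg, hr.addCol hg⟩

theorem HasPerm.hasRecords {σ : Equiv.Perm (Fin n)} (h : T.HasPerm σ) : T.HasRecords σ := by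
  obtain ⟨ρ, h1, h2⟩ := T.exists_hasPerm_hasRecords
  rwa [h.unique h1]

/-- The decomposition of a tableau with at least one border step, together with its
permutation. -/
theorem HasPerm.exists_decomposition {T : PermTableau (n + 1)} {σ : Equiv.Perm (Fin (n + 1))}
    (h : T.HasPerm σ) :
    ∃ (T' : PermTableau n) (f : Equiv.Perm (Fin n)) (S : Finset ℕ)
      (hS : ∀ r ∈ S, r < T'.rows ∧ T'.Unrestricted r), T'.HasPerm f ∧
      IsExt (T'.rowLabels S) f σ ∧ (∀ i ∈ T'.rowLabels S, IsRecord f i) ∧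
      ((S = ∅ ∧ T = T'.addRow) ∨ ∃ hne : S.Nonempty, T = T'.addCol S hne hS) := by
  rcases T.eq_addRow_or_eq_addCol with ⟨T', rfl⟩ | ⟨T', S, hne, hS, rfl⟩
  · obtain ⟨f, hf, hr⟩ := T'.exists_hasPerm_hasRecords
    have hS : ∀ r ∈ (∅ : Finset ℕ), r < T'.rows ∧ T'.Unrestricted r := by simp
    have he : T'.rowLabels ∅ = ∅ := by ext; simp [mem_rowLabels]
    obtain ⟨g, hg⟩ := exists_isExt ∅ f
    rw [← (hf.addRow hg).unique h]
    exact ⟨T', f, ∅, hS, hf, he ▸ hg, hr.isRecord hS, Or.inl ⟨rfl, rfl⟩⟩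
  · obtain ⟨f, hf, hr⟩ := T'.exists_hasPerm_hasRecords
    obtain ⟨g, hg⟩ := exists_isExt (T'.rowLabels S) f
    rw [← (hf.addCol hg).unique h]
    exact ⟨T', f, S, hS, hf, hg, hr.isRecord hS, Or.inr ⟨hne, rfl⟩⟩

/-- The permutation determines the labels of `S` by `IsExt.mem_iff` and the smaller permutation by
`IsExt.unique_left`; induction recovers the smaller tableau, and emptiness of `S` tells whether a
row or a column was added. -/
theorem HasPerm.injective : ∀ {n : ℕ} {T₁ T₂ : PermTableau n} {σ : Equiv.Perm (Fin n)},
    T₁.HasPerm σ → T₂.HasPerm σ → T₁ = T₂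
  | 0, T₁, T₂, _, _, _ => by
    have h1 := T₁.rows_add_cols
    have h2 := T₂.rows_add_cols
    have e1 : ∀ x, x ∉ T₁.shape := fun x hx => by have := T₁.shape_sub x.1 x.2 hx; omega
    have e2 : ∀ x, x ∉ T₂.shape := fun x hx => by have := T₂.shape_sub x.1 x.2 hx; omega
    ext x
    · omega
    · omega
    · exact iff_of_false (e1 x) (e2 x)
    · exact iff_of_false (fun h => e1 x (T₁.ones_sub x.1 x.2 h))
        (fun h => e2 x (T₂.ones_sub x.1 x.2 h))
  | n + 1, T₁, T₂, σ, h₁, h₂ => by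
    obtain ⟨T₁', f₁, S₁, hS₁, hf₁, hg₁, hr₁, hT₁⟩ := h₁.exists_decomposition
    obtain ⟨T₂', f₂, S₂, hS₂, hf₂, hg₂, hr₂, hT₂⟩ := h₂.exists_decomposition
    have hS : T₁'.rowLabels S₁ = T₂'.rowLabels S₂ := by
      ext i
      rw [hg₁.mem_iff hr₁, hg₂.mem_iff hr₂]
    have hf : f₁ = f₂ := by
      rw [← hS] at hg₂
      exact DFunLike.coe_injective (hg₁.unique_left hg₂)
    subst hf
    have hT := HasPerm.injective hf₁ hf₂
    subst hT
    have hS' : S₁ = S₂ := by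
      have key : ∀ S, (∀ r ∈ S, r < T₁'.rows ∧ T₁'.Unrestricted r) → ∀ r, r ∈ S ↔
          ∃ i ∈ T₁'.rowLabels S, (i : ℕ) = T₁'.rowLabel r := by
        intro S hS r
        constructor
        · intro hr
          exact ⟨⟨_, T₁'.rowLabel_lt (hS r hr).1⟩, (mem_rowLabels_of_eq rfl).2 hr, rfl⟩
        · rintro ⟨i, hi, hir⟩
          exact (mem_rowLabels_of_eq hir).1 hi
      ext r
      rw [key S₁ hS₁, key S₂ hS₂, hS]
    subst hS'
    rcases hT₁ with ⟨e₁, rfl⟩ | ⟨hne₁, rfl⟩ <;> rcases hT₂ with ⟨e₂, rfl⟩ | ⟨hne₂, rfl⟩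
    · rfl
    · exact absurd e₁ hne₂.ne_empty
    · exact absurd e₂ hne₁.ne_empty
    · rfl

theorem exists_hasPerm : ∀ {n : ℕ} (σ : Equiv.Perm (Fin n)), ∃ T : PermTableau n, T.HasPerm σ
  | 0, _ => ⟨{
      rows := 0
      cols := 0
      rows_add_cols := rfl
      shape := ⊥
      shape_sub := fun r c h => absurd h (YoungDiagram.notMem_bot _)
      ones := ∅
      ones_sub := fun r c h => absurd h (Finset.notMem_empty _)
      column := fun c hc => absurd hc (Nat.not_lt_zero _)
      hinge := fun r _ c _ _ _ h => absurd h (YoungDiagram.notMem_bot _) },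
      fun i => i.elim0, fun i => i.elim0⟩
  | n + 1, σ => by
    classical
    obtain ⟨L, f, hg, hr⟩ := exists_isExt_left σ
    obtain ⟨T, hf⟩ := exists_hasPerm f
    have hrec := hf.hasRecords
    rcases L.eq_empty_or_nonempty with rfl | hL
    · exact ⟨T.addRow, hf.addRow hg⟩
    · set S : Finset ℕ := (Finset.range T.rows).filter fun r => ∃ i ∈ L, (i : ℕ) = T.rowLabel r
        with hSdef
      have mS : ∀ r, r ∈ S ↔ r < T.rows ∧ ∃ i ∈ L, (i : ℕ) = T.rowLabel r := by simp [hSdef]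
      have hS : ∀ r ∈ S, r < T.rows ∧ T.Unrestricted r := by
        intro r hrS
        obtain ⟨hrr, i, hi, hir⟩ := (mS r).1 hrS
        exact ⟨hrr, (hrec.iff_of_eq hrr hir).1 (hr i hi)⟩
      have hLS : T.rowLabels S = L := by
        ext i
        rw [mem_rowLabels]
        constructor
        · rintro ⟨r, hrS, hir⟩
          obtain ⟨_, j, hj, hjr⟩ := (mS r).1 hrS
          rwa [Fin.ext (hir.trans hjr.symm)]
        · intro hi
          obtain ⟨r, hrr, hir, _⟩ := (hrec i).1 (hr i hi)
          exact ⟨r, (mS r).2 ⟨hrr, i, hi, hir⟩, hir⟩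
      have hne : S.Nonempty := by
        obtain ⟨i, hi⟩ := hL
        rw [← hLS, mem_rowLabels] at hi
        obtain ⟨r, hrS, _⟩ := hi
        exact ⟨r, hrS⟩
      exact ⟨T.addCol S hne hS, hf.addCol (hLS.symm ▸ hg)⟩

/-- The bijection `Φ`. -/
noncomputable def phiEquiv (n : ℕ) : PermTableau n ≃ Equiv.Perm (Fin n) :=
  Equiv.ofBijective (fun T => T.exists_hasPerm_hasRecords.choose)
    ⟨fun T₁ T₂ h => HasPerm.injective T₁.exists_hasPerm_hasRecords.choose_spec.1
      (by simp only at h; rw [h]; exact T₂.exists_hasPerm_hasRecords.choose_spec.1),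
    fun σ => by
      obtain ⟨T, hT⟩ := exists_hasPerm σ
      exact ⟨T, T.exists_hasPerm_hasRecords.choose_spec.1.unique hT⟩⟩

theorem hasPerm_phiEquiv (T : PermTableau n) : T.HasPerm (phiEquiv n T) :=
  T.exists_hasPerm_hasRecords.choose_spec.1

end PermTableau

/-! ### Nondecreasing tableaux and 3-2-1-avoiding permutations. -/

namespace PermTableau

open CycleExt

variable {n : ℕ} {T : PermTableau n}

theorem rowLen_eq_of {r c : ℕ} (h : (r, c) ∉ T.shape) (h' : ∀ d < c, (r, d) ∈ T.shape) :
    T.shape.rowLen r = c := by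
  refine eq_of_forall_lt_iff fun d => ?_
  rw [← YoungDiagram.mem_iff_lt_rowLen]
  exact ⟨fun hd => by
    by_contra hlt
    exact h (T.mem_shape_of_le le_rfl (not_lt.1 hlt) hd), h' d⟩

theorem colLen_eq_of {r c : ℕ} (h : (r, c) ∉ T.shape) (h' : ∀ s < r, (s, c) ∈ T.shape) :
    T.shape.colLen c = r := by
  refine eq_of_forall_lt_iff fun s => ?_
  rw [← YoungDiagram.mem_iff_lt_colLen]
  exact ⟨fun hd => by
    by_contra hlt
    exact h (T.mem_shape_of_le (not_lt.1 hlt) le_rfl hd), h' s⟩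

/-- In a tableau with nondecreasing rows and columns, a path follows a diagonal after its first
one. -/
theorem Nondecreasing.exitLabel_of_one (hT : T.Nondecreasing) (r c : ℕ) (h : (r, c) ∈ T.ones) :
    T.exitLabel true r c = r + (T.cols - c) ∧ T.exitLabel false r c + 1 = r + (T.cols - c) := by
  revert h
  refine T.cell_induction (P := fun r c => (r, c) ∈ T.ones →
    T.exitLabel true r c = r + (T.cols - c) ∧ T.exitLabel false r c + 1 = r + (T.cols - c))
    (fun r c h h' => absurd (T.ones_sub r c h') h) ?_ r c
  intro r c hsh ih1 ih2 h
  have hc := (T.shape_sub r c hsh).2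
  rw [exitLabel_east_of_one h, exitLabel_south_of_one h]
  constructor
  · by_cases h2 : (r + 1, c) ∈ T.shape
    · have := (ih2 (hT.2 r (r + 1) c (Nat.le_succ r) h2 h)).2
      omega
    · rw [exitLabel_south_of_notMem h2, colLabel, colLen_eq_of h2 fun s hs =>
        T.mem_shape_of_le (by omega) le_rfl hsh]
      omega
  · by_cases h2 : (r, c + 1) ∈ T.shape
    · rw [(ih1 (hT.1 r c (c + 1) (Nat.le_succ c) h2 h)).1]
      have := (T.shape_sub r _ h2).2
      omega
    · rw [exitLabel_east_of_notMem h2, rowLabel, rowLen_eq_of h2 fun s hs =>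
        T.mem_shape_of_le le_rfl (by omega) hsh]
      omega

theorem exitLabel_east_of_zeros {r c : ℕ} (h : ∀ d < c, (r, d) ∈ T.shape ∧ (r, d) ∉ T.ones) :
    T.exitLabel true r 0 = T.exitLabel true r c := by
  induction c with
  | zero => rfl
  | succ c ih =>
    rw [ih fun d hd => h d (by omega),
      exitLabel_east_of_zero (h c (by omega)).1 (h c (by omega)).2]

theorem exitLabel_south_of_zeros {r c : ℕ} (h : ∀ s < r, (s, c) ∈ T.shape ∧ (s, c) ∉ T.ones) :
    T.exitLabel false 0 c = T.exitLabel false r c := by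
  induction r with
  | zero => rfl
  | succ r ih =>
    rw [ih fun d hd => h d (by omega),
      exitLabel_south_of_zero (h r (by omega)).1 (h r (by omega)).2]

theorem exists_first_nonzero (T : PermTableau n) (r : ℕ) :
    ∃ z, ((r, z) ∉ T.shape ∨ (r, z) ∈ T.ones) ∧ ∀ d < z, (r, d) ∈ T.shape ∧ (r, d) ∉ T.ones := by
  classical
  have hex : ∃ z, (r, z) ∉ T.shape ∨ (r, z) ∈ T.ones :=
    ⟨T.cols, Or.inl fun h => lt_irrefl _ (T.shape_sub _ _ h).2⟩
  refine ⟨Nat.find hex, Nat.find_spec hex, fun d hd => ?_⟩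
  have := Nat.find_min hex hd
  tauto

theorem exists_first_one (T : PermTableau n) {c : ℕ} (hc : c < T.cols) :
    ∃ w, (w, c) ∈ T.ones ∧ ∀ s < w, (s, c) ∈ T.shape ∧ (s, c) ∉ T.ones := by
  classical
  have hex := T.column c hc
  exact ⟨Nat.find hex, Nat.find_spec hex, fun s hs =>
    ⟨T.mem_shape_of_le hs.le le_rfl (T.ones_sub _ _ (Nat.find_spec hex)), Nat.find_min hex hs⟩⟩

/-- One formula covers both cases: if the row has no one, `z` is its length and the path ends at the
label of the row itself. -/
theorem Nondecreasing.exitLabel_row (hT : T.Nondecreasing) {r z : ℕ}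
    (h : (r, z) ∉ T.shape ∨ (r, z) ∈ T.ones)
    (hz : ∀ d < z, (r, d) ∈ T.shape ∧ (r, d) ∉ T.ones) :
    z ≤ T.shape.rowLen r ∧ T.exitLabel true r 0 = r + (T.cols - z) := by
  constructor
  · by_contra hlt
    exact lt_irrefl _ (YoungDiagram.mem_iff_lt_rowLen.1 (hz _ (not_le.1 hlt)).1)
  · rw [exitLabel_east_of_zeros hz]
    rcases h with h | h
    · rw [exitLabel_east_of_notMem h, rowLabel, rowLen_eq_of h fun d hd => (hz d hd).1]
    · exact (hT.exitLabel_of_one r z h).1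

theorem Nondecreasing.exitLabel_column (hT : T.Nondecreasing) {w c : ℕ} (h : (w, c) ∈ T.ones)
    (hw : ∀ s < w, (s, c) ∈ T.shape ∧ (s, c) ∉ T.ones) :
    T.exitLabel false 0 c + 1 = w + (T.cols - c) := by
  rw [exitLabel_south_of_zeros hw]
  exact (hT.exitLabel_of_one w c h).2

/-- Going down, the first nonzero place of a row moves weakly to the left, so both terms of the
formula in `Nondecreasing.exitLabel_row` favour the lower row. -/
theorem Nondecreasing.exitLabel_row_lt (hT : T.Nondecreasing) {r r' : ℕ} (hr : r < r') :
    T.exitLabel true r 0 < T.exitLabel true r' 0 := by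
  obtain ⟨z, h, hz⟩ := T.exists_first_nonzero r
  obtain ⟨z', h', hz'⟩ := T.exists_first_nonzero r'
  have e := hT.exitLabel_row h hz
  have e' := hT.exitLabel_row h' hz'
  have hle : z' ≤ z := by
    by_contra hlt
    obtain ⟨k1, k2⟩ := hz' z (not_le.1 hlt)
    rcases h with h | h
    · exact h (T.mem_shape_of_le hr.le le_rfl k1)
    · exact k2 (hT.2 r r' z hr.le k1 h)
  omega

theorem Nondecreasing.rowLabel_le (hT : T.Nondecreasing) (r : ℕ) :
    T.rowLabel r ≤ T.exitLabel true r 0 := by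
  obtain ⟨z, h, hz⟩ := T.exists_first_nonzero r
  have e := hT.exitLabel_row h hz
  unfold rowLabel
  omega

theorem Nondecreasing.exitLabel_column_lt (hT : T.Nondecreasing) {c c' : ℕ} (hc : c < c')
    (hc' : c' < T.cols) : T.exitLabel false 0 c' < T.exitLabel false 0 c := by
  obtain ⟨w, h, hw⟩ := T.exists_first_one (hc.trans hc')
  obtain ⟨w', h', hw'⟩ := T.exists_first_one hc'
  have e := hT.exitLabel_column h hw
  have e' := hT.exitLabel_column h' hw'
  have hle : w' ≤ w := by
    by_contra hlt
    obtain ⟨k1, k2⟩ := hw' w (not_le.1 hlt)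
    exact k2 (hT.1 w c c' hc.le k1 h)
  omega

theorem Nondecreasing.lt_colLabel (hT : T.Nondecreasing) {c : ℕ} (hc : c < T.cols) :
    T.exitLabel false 0 c < T.colLabel c := by
  obtain ⟨w, h, hw⟩ := T.exists_first_one hc
  have e := hT.exitLabel_column h hw
  have := YoungDiagram.mem_iff_lt_colLen.1 (T.ones_sub _ _ h)
  unfold colLabel
  omega

/-- The weak excedances are exactly the row labels, and the images increase with the labels on rows
and on columns separately, so the criterion `mem_avoiders_321_iff` applies. -/
theorem Nondecreasing.mem_avoiders (hT : T.Nondecreasing) {σ : Equiv.Perm (Fin n)}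
    (hσ : T.HasPerm σ) : σ ∈ avoiders n pat3_2_1 := by
  rw [SteinWil.mem_avoiders_321_iff]
  have hrow : ∀ i, i ≤ σ i → ∃ r < T.rows, (i : ℕ) = T.rowLabel r := by
    intro i hi
    refine (T.exists_label i).resolve_right ?_
    rintro ⟨c, hc, hic⟩
    have h1 := hσ.2 i c hc hic
    have h2 := hT.lt_colLabel hc
    rw [Fin.le_def] at hi
    omega
  have hcol : ∀ i, σ i < i → ∃ c < T.cols, (i : ℕ) = T.colLabel c := by
    intro i hi
    refine (T.exists_label i).resolve_left ?_
    rintro ⟨r, hr, hir⟩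
    have h1 := hσ.1 i r hr hir
    have h2 := hT.rowLabel_le r
    rw [Fin.lt_def] at hi
    omega
  constructor
  · intro x a hxa ha
    obtain ⟨r', hr', ha'⟩ := hrow a ha
    rcases lt_or_ge (σ x) x with hx | hx
    · exact (hx.trans (hxa.trans_le ha)).le
    · obtain ⟨r, hr, hx'⟩ := hrow x hx
      have hlt : r < r' := by
        rw [Fin.lt_def, hx', ha'] at hxa
        exact T.rowLabel_strictMono.lt_iff_lt.1 hxa
      rw [Fin.le_def, hσ.1 x r hr hx', hσ.1 a r' hr' ha']
      exact (hT.exitLabel_row_lt hlt).le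
  · intro c x hcx hc hxc
    obtain ⟨k, hk, hk'⟩ := hcol c hc
    obtain ⟨l, hl, hl'⟩ := hcol x (hxc.trans hcx)
    have hlt : l < k := by
      by_contra hle
      rw [Fin.lt_def, hk', hl'] at hcx
      rcases (not_lt.1 hle).eq_or_lt with e | e
      · rw [e] at hcx
        exact lt_irrefl _ hcx
      · exact lt_asymm hcx (T.colLabel_lt_colLabel e hl)
    rw [Fin.le_def, hσ.2 c k hk hk', hσ.2 x l hl hl']
    exact (hT.exitLabel_column_lt hlt hk).le

theorem Nondecreasing.addCol (hT : T.Nondecreasing) {S : Finset ℕ} (hne : S.Nonempty)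
    (hS : ∀ r ∈ S, r < T.rows ∧ T.Unrestricted r) {r₀ : ℕ} (hS₀ : S = Finset.Ico r₀ T.rows)
    (h₀ : (r₀, 0) ∉ T.shape ∨ (r₀, 0) ∈ T.ones) : (T.addCol S hne hS).Nondecreasing := by
  have mS : ∀ r, r ∈ S ↔ r₀ ≤ r ∧ r < T.rows := fun r => by rw [hS₀, Finset.mem_Ico]
  have hone : ∀ r c, r₀ ≤ r → (r, c) ∈ T.shape → (r, c) ∈ T.ones := by
    intro r c hr hrc
    have h1 : (r₀, c) ∈ T.shape := T.mem_shape_of_le hr le_rfl hrc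
    -- Once a row from `r₀` on is nonempty, the leftmost cell of row `r₀` must be a one, and
    -- monotonicity spreads ones over all cells from that row down.
    have h2 := h₀.resolve_left fun h => h (T.mem_shape_of_le le_rfl (Nat.zero_le c) h1)
    exact hT.2 r₀ r c hr hrc (hT.1 r₀ 0 c (Nat.zero_le c) h1 h2)
  constructor
  · intro r c c' hcc hsh ho
    rcases c' with _ | c'
    · rwa [Nat.le_zero.1 hcc] at ho
    · rw [mem_addCol_shape_succ] at hsh
      rw [mem_addCol_ones_succ]
      rcases c with _ | c
      · rw [mem_addCol_ones_zero, mS] at ho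
        exact hone r c' ho.1 hsh
      · rw [mem_addCol_ones_succ] at ho
        exact hT.1 r c c' (by omega) hsh ho
  · intro r r' c hrr hsh ho
    rcases c with _ | c
    · rw [mem_addCol_shape_zero] at hsh
      rw [mem_addCol_ones_zero, mS] at *
      exact ⟨ho.1.trans hrr, hsh⟩
    · rw [mem_addCol_shape_succ] at hsh
      rw [mem_addCol_ones_succ] at *
      exact hT.2 r r' c hrr hsh ho

theorem card_rowLabels {S : Finset ℕ} (hS : ∀ r ∈ S, r < T.rows) :
    (T.rowLabels S).card = S.card := by
  symm
  refine Finset.card_bij (fun r hr => ⟨T.rowLabel r, T.rowLabel_lt (hS r hr)⟩) ?_ ?_ ?_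
  · intro r hr
    exact (mem_rowLabels_of_eq rfl).2 hr
  · intro r _ r' _ h
    exact T.rowLabel_strictMono.injective (Fin.mk.inj_iff.1 h)
  · intro i hi
    obtain ⟨r, hr, hi⟩ := mem_rowLabels.1 hi
    exact ⟨r, hr, Fin.ext hi.symm⟩

/-- By induction it suffices to control the new column. `IsExt.avoids` makes every row whose value
is at least that of the first row `r₀` of `S` belong to `S`, and counting then shows that `S`
consists of all rows from `r₀` on. -/
theorem HasPerm.nondecreasing : ∀ {n : ℕ} {T : PermTableau n} {σ : Equiv.Perm (Fin n)},
    T.HasPerm σ → σ ∈ avoiders n pat3_2_1 → T.Nondecreasing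
  | 0, T, _, _, _ => by
    have h1 := T.rows_add_cols
    have e1 : ∀ r c, (r, c) ∉ T.shape := fun r c hx => by have := T.shape_sub r c hx; omega
    exact ⟨fun r c c' _ h => absurd h (e1 _ _), fun r r' c _ h => absurd h (e1 _ _)⟩
  | n + 1, T, σ, h, hσ => by
    obtain ⟨T', f, S, hS, hf, hg, hr, hT⟩ := h.exists_decomposition
    obtain ⟨hav, hbig⟩ := hg.avoids hr hσ
    have hT' := hf.nondecreasing hav
    rcases hT with ⟨-, rfl⟩ | ⟨hne, rfl⟩
    · exact hT'
    · set r₀ := S.min' hne with hr₀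
      have hr₀S : r₀ ∈ S := S.min'_mem hne
      have hr₀r := (hS r₀ hr₀S).1
      obtain ⟨z, hz, hz'⟩ := T'.exists_first_nonzero r₀
      obtain ⟨hz1, hz2⟩ := hT'.exitLabel_row hz hz'
      have hzc := hz1.trans (T'.rowLen_le_cols r₀)
      set i₀ : Fin n := ⟨T'.rowLabel r₀, T'.rowLabel_lt hr₀r⟩ with hi₀
      have hi₀S : i₀ ∈ T'.rowLabels S := (mem_rowLabels_of_eq rfl).2 hr₀S
      have hfi : (f i₀ : ℕ) = r₀ + (T'.cols - z) := by
        rw [← hz2]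
        exact hf.1 i₀ r₀ hr₀r rfl
      have hmin : ∀ t ∈ T'.rowLabels S, i₀ ≤ t := by
        intro t ht
        obtain ⟨s, hs, hts⟩ := mem_rowLabels.1 ht
        rw [Fin.le_def, hts]
        exact T'.rowLabel_strictMono.monotone (S.min'_le s hs)
      have hsub : (Finset.Ici (f i₀)).map f.symm.toEmbedding ⊆ T'.rowLabels S := by
        intro i hi
        simp only [Finset.mem_map_equiv, Equiv.symm_symm, Finset.mem_Ici] at hi
        rcases hi.eq_or_lt with e | e
        · rwa [← f.injective e]
        · exact hbig i₀ hi₀S hmin i e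
      have hcard := Finset.card_le_card hsub
      rw [Finset.card_map, Fin.card_Ici, card_rowLabels fun r hr => (hS r hr).1, hfi] at hcard
      have hSI : S ⊆ Finset.Ico r₀ T'.rows := fun s hs =>
        Finset.mem_Ico.2 ⟨S.min'_le s hs, (hS s hs).1⟩
      have hcard' := Finset.card_le_card hSI
      rw [Nat.card_Ico] at hcard'
      have hsum := T'.rows_add_cols
      -- There are `n - (r₀ + cols - z) = (rows - r₀) + z` values from `f i₀` on, all at labels of
      -- `S`, while `S` has at most `rows - r₀` elements. So `z = 0` and equality holds.
      have hz0 : z = 0 := by omega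
      subst hz0
      refine hT'.addCol hne hS (Finset.eq_of_subset_of_card_le hSI ?_) hz
      rw [Nat.card_Ico]
      omega

end PermTableau

theorem mainTheorem5 (n : ℕ) :
    ∃ (Ψ : Equiv.Perm (Fin n) ≃ Equiv.Perm (Fin n)) (Φ : PermTableau n ≃ Equiv.Perm (Fin n)),
      (∀ (π : Equiv.Perm (Fin n)) (i : Fin n), Ψ π i = SteinWil.psiFun π i) ∧
      (∀ T : PermTableau n, T.HasPerm (Φ T)) ∧
      Ψ '' avoiders n pat31_2 = avoiders n pat3_2_1 ∧
      Ψ '' avoiders n pat31_2 = {σ | (Φ.symm σ).Nondecreasing} := by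
  refine ⟨SteinWil.psiEquiv, PermTableau.phiEquiv n, fun _ _ => rfl,
    PermTableau.hasPerm_phiEquiv, SteinWil.psiEquiv_image_avoiders, ?_⟩
  rw [SteinWil.psiEquiv_image_avoiders]
  ext σ
  have h : ((PermTableau.phiEquiv n).symm σ).HasPerm σ := by
    simpa using PermTableau.hasPerm_phiEquiv ((PermTableau.phiEquiv n).symm σ)
  exact ⟨fun hσ => h.nondecreasing hσ, fun hT => PermTableau.Nondecreasing.mem_avoiders hT h⟩
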